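/- Let $n,K\ge 1$ be integers, $L,D>0$, and let $X\subseteq\mathbb R^n$ be a nonempty convex compact set with $\sup_{x\in X}\|x\|\le D$ (Euclidean norm). Let $F$ be a real function on $\mathbb R^n$ that is convex and $L$-Lipschitz on a convex set $U$ containing every closed neighbourhood $\{z:\operatorname{dist}(z,X)\le h_t\}$ of $X$ for the smoothing parameters $h_t$ used below. For $h>0$ let $F_h(x)$ be the mean of $F(x+hy)$ over $y$ uniform in the closed unit ball. There is an absolute constant $C$ such that for all $n\ge1$, all $L$-Lipschitz $F:\mathbb R^n\to\mathbb R$, all $x\in\mathbb R^n$ and $h>0$, $$\mathbb E\Big\|\tfrac1{2h}\big(F(x+h\tilde y)-F(x-h\tilde y)\big)\tilde y\Big\|^2\le \frac{CL^2}{n},\qquad \tilde y\text{ uniform on the unit sphere},$$ and for every such constant $C$ the following holds. Let $x_1\in X$ and $x_{t+1}=\pi_X(x_t-\rho_t\eta_t)$, $t\ge1$, where $\pi_X$ is the projection on $X$ and $$\eta_t=\frac1K\sum_{k=1}^K\frac{1}{2h_t}\big(F(x_t+h_t\tilde y_t^k)-F(x_t-h_t\tilde y_t^k)\big)\tilde y_t^k,$$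 the vectors $\tilde y_t^k$ ($t\ge 1$, $1\le k\le K$) being independent and uniformly distributed on the unit sphere. 1. For $T\ge1$, constant step $\rho_t=\frac{D\sqrt{nK}}{L\sqrt{2T(C+K/n)}}$, constant $h_t=h>0$ and $\bar x_T=\frac1T\sum_{t=1}^T x_t$, $$\mathbb E F_h(\bar x_T)-\min_X F_h\le \frac52\cdot\frac{LD}{\sqrt T}\sqrt{\frac{2n}{K}}\Big(C+\frac Kn\Big)^{1/2},$$ and the factor $\frac52$ may be dropped if moreover $\|x_1-x^*\|\le D$ for some minimizer $x^*$ of $F_h$ on $X$. 2. For steps $\rho_t=\frac{D\sqrt{nK}}{L\sqrt{2t(C+K/n)}}$, constant $h_t=h>0$, $\bar x_t=\sum_{\tau=1}^t\rho_\tau x_\tau/\sum_{\tau=1}^t\rho_\tau$ and $t\ge2$, $$\mathbb E F_h(\bar x_t)-\min_X F_h\le \frac{DL}{\sqrt2}\sqrt{\frac nK}\Big(C+\frac Kn\Big)^{1/2}\frac{2+\ln t}{\sqrt t-1}.$$ 3. For the steps and averages of 2, smoothing parameters $h_t=L\rho_t/K$ and $t\ge2$, $$\mathbb E F(\bar x_t)-\min_X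 F\le \frac{DL}{2}\sqrt{\frac nK}\Big(2+C+\frac Kn\Big)^{1/2}\frac{2+\ln t}{\sqrt t-1}.$$ All these expectations exist and the minima are attained. -/

import Mathlib

open MeasureTheory ProbabilityTheory
open scoped NNReal

noncomputable section

/-- The uniform probability distribution on the Euclidean unit sphere of `ℝⁿ`, as a measure on
`ℝⁿ`: the normalized surface measure, pushed forward along the inclusion of the sphere. -/
def sphereUniform (n : ℕ) : Measure (EuclideanSpace ℝ (Fin n)) :=
  (((volume : Measure (EuclideanSpace ℝ (Fin n))).toSphere Set.univ)⁻¹ •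
      (volume : Measure (EuclideanSpace ℝ (Fin n))).toSphere).map Subtype.val

/-- Ball smoothing: `F_h(x)` is the average of `F (x + h y)` over `y` in the closed unit ball. -/
def ballSmoothing {n : ℕ} (F : EuclideanSpace ℝ (Fin n) → ℝ) (h : ℝ)
    (x : EuclideanSpace ℝ (Fin n)) : ℝ :=
  ⨍ y in Metric.closedBall (0 : EuclideanSpace ℝ (Fin n)) 1, F (x + h • y)

/-- The central finite difference of `F` at `z` with step `h` along `v`, times the vector `v`. -/
def centralDifference {n : ℕ} (F : EuclideanSpace ℝ (Fin n) → ℝ) (h : ℝ)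
    (z v : EuclideanSpace ℝ (Fin n)) : EuclideanSpace ℝ (Fin n) :=
  (1 / (2 * h) * (F (z + h • v) - F (z - h • v))) • v

/-- The batch direction: the mean of `K` central differences along `v 0, …, v (K - 1)`. -/
def batchDirection {n K : ℕ} (F : EuclideanSpace ℝ (Fin n) → ℝ) (h : ℝ)
    (z : EuclideanSpace ℝ (Fin n)) (v : Fin K → EuclideanSpace ℝ (Fin n)) :
    EuclideanSpace ℝ (Fin n) :=
  (1 / (K : ℝ)) • ∑ k, centralDifference F h z (v k)

/-- `C` is an admissible absolute constant in the second moment estimate for the central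
differences along a uniform direction: `E ‖(F(x+hy) - F(x-hy)) y / (2h)‖² ≤ C L² / n` in every
dimension `n ≥ 1`, for every `L`-Lipschitz `F`, every point `x` and every `h > 0`. -/
def IsDifferenceConstant (C : ℝ) : Prop :=
  ∀ (n : ℕ), 1 ≤ n → ∀ (L : ℝ≥0) (F : EuclideanSpace ℝ (Fin n) → ℝ), LipschitzWith L F →
    ∀ (x : EuclideanSpace ℝ (Fin n)) (h : ℝ), 0 < h →
      ∫ v, ‖centralDifference F h x v‖ ^ 2 ∂(sphereUniform n) ≤ C * (L : ℝ) ^ 2 / n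

/-- `p` is the Euclidean projection of `z` on `X` (a nearest point of `X`, which is unique when
`X` is convex). -/
def IsProjection {n : ℕ} (X : Set (EuclideanSpace ℝ (Fin n)))
    (z p : EuclideanSpace ℝ (Fin n)) : Prop :=
  p ∈ X ∧ ∀ q ∈ X, ‖z - p‖ ≤ ‖z - q‖

/-- The directions `y t k`, `t ≥ 1`, `k < K`, are independent and uniform on the unit sphere. -/
structure IsDirectionSample {n K : ℕ} {Ω : Type*} [MeasurableSpace Ω] (P : Measure Ω)
    (y : ℕ → Fin K → Ω → EuclideanSpace ℝ (Fin n)) : Prop where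
  hasLaw : ∀ t, 1 ≤ t → ∀ k, HasLaw (y t k) (sphereUniform n) P
  indep : iIndepFun (fun p : ℕ × Fin K => y (p.1 + 1) p.2) P

/-- `x 1, x 2, …` is the trajectory of the projected finite-difference method on `X` started at
`x₁`, with steps `ρ t`, smoothing parameters `h t` and directions `y t k`. -/
structure IsTrajectory {n K : ℕ} {Ω : Type*} (X : Set (EuclideanSpace ℝ (Fin n)))
    (F : EuclideanSpace ℝ (Fin n) → ℝ) (ρ h : ℕ → ℝ)
    (y : ℕ → Fin K → Ω → EuclideanSpace ℝ (Fin n)) (x₁ : EuclideanSpace ℝ (Fin n))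
    (x : ℕ → Ω → EuclideanSpace ℝ (Fin n)) : Prop where
  start : ∀ ω, x 1 ω = x₁
  step : ∀ t, 1 ≤ t → ∀ ω,
    IsProjection X (x t ω - ρ t • batchDirection F (h t) (x t ω) (fun k => y t k ω))
      (x (t + 1) ω)

/-- The weighted average `∑_{τ=1}^t ρ_τ x_τ / ∑_{τ=1}^t ρ_τ` of the trajectory. -/
def trajectoryAverage {n : ℕ} {Ω : Type*} (ρ : ℕ → ℝ) (x : ℕ → Ω → EuclideanSpace ℝ (Fin n))
    (t : ℕ) (ω : Ω) : EuclideanSpace ℝ (Fin n) :=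
  (∑ τ ∈ Finset.Icc 1 t, ρ τ)⁻¹ • ∑ τ ∈ Finset.Icc 1 t, ρ τ • x τ ω

/-- The step `D √(nK) / (L √(2 s (C + K/n)))`. -/
def stepSize (n K : ℕ) (L D C s : ℝ) : ℝ :=
  D * √((n : ℝ) * K) / (L * √(2 * s * (C + (K : ℝ) / n)))

/-- `E G(z) - min_X G ≤ b`, where the expectation exists and the minimum is attained. -/
def ExpectedErrorLE {n : ℕ} {Ω : Type*} [MeasurableSpace Ω] (P : Measure Ω)
    (G : EuclideanSpace ℝ (Fin n) → ℝ) (X : Set (EuclideanSpace ℝ (Fin n)))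
    (z : Ω → EuclideanSpace ℝ (Fin n)) (b : ℝ) : Prop :=
  Integrable (fun ω => G (z ω)) P ∧
    ∃ m, IsLeast (G '' X) m ∧ ∫ ω, G (z ω) ∂P - m ≤ b

end

/-!
Write `m(x)` for the mean of the central difference `(F(x + h v) - F(x - h v)) v / (2h)` over a
uniform unit vector `v`. Three facts about it make the method a projected stochastic subgradient
method for the smoothed function `F_h`.

* *The mean is a subgradient.* The divergence theorem on the unit ball turns `⟪m(x), w⟫` into
  `1 / (n h)` times the mean over the ball of the derivative of `y ↦ F(x + h y)` along `w`. So
  `n m(x)` is a subgradient of `F_h` at `x` (`ballSmoothing_sub_le_inner`), and `‖m(x)‖ ≤ L / n`.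
  As `F` is merely Lipschitz, the divergence theorem is obtained from integration by parts against
  cutoffs that are affine in the norm on a thin shell (`setIntegral_lineDeriv_closedBall`).
* *The second moment is `O(L² / n)`.* The quotient `g(v) = (F(x + h v) - F(x - h v)) / (2h)` is odd
  and `L`-Lipschitz, with `|g| ≤ L` on the sphere. Its extension of degree one, `‖x‖ g(x / ‖x‖)`, is
  odd and `3L`-Lipschitz, and its second Gaussian moment is `n` times the second moment of `g` on
  the sphere. A Gaussian Poincaré inequality for odd functions (`integral_sq_odd_le`) bounds it, and
  gives the admissible constant `9π²/4` (`isDifferenceConstant_pi`). It is proved by rotating a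
  Gaussian vector into its negative through an independent copy.
* *Averaging a batch.* The diagonal terms of the second moment of the batch direction are bounded
  by `C L² / n`, the off-diagonal ones by `(L / n)²`, in total `L² / (nK) * (C + K / n)`.

Since the projection is nonexpansive, expanding the square gives
`E‖x_{t+1} - z‖² ≤ E‖x_t - z‖² - (2ρ_t / n) E(F_h(x_t) - F_h(z)) + ρ_t² L² / (nK) * (C + K / n)`.
Telescoping and Jensen's inequality bound the error of the averaged trajectory
(`expected_gap_trajectoryAverage_le`). When the target is `F` itself, `F ≤ F_h ≤ F + L h` on `X`
adds the term `ρ_t L h_t` to each gap.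

`F` is controlled only on `U`, and may even fail to be measurable outside. All estimates are
therefore made for a Lipschitz extension of `F`, and for the measurable process that it drives;
this process coincides almost surely with the trajectory, since the balls that matter lie in `U`.

For the explicit constants, `∑_{t ≤ T} 1 / √t ≥ 2√T - 3/2` and `∑_{t ≤ T} 1 / t ≤ 1 + log T` are used
with `‖x₁ - z‖ ≤ 2D`. For decreasing smoothing parameters the ratio `1 + 2 / (C + K / n)` enters; it
is at most `3` because every admissible constant satisfies `C ≥ 1`
(`one_le_of_isDifferenceConstant`).
-/

open Filter Topology

/-! ### The uniform distribution on the sphere -/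

section Sphere

variable {n : ℕ}

theorem nontrivial_euclideanSpace (hn : 1 ≤ n) : Nontrivial (EuclideanSpace ℝ (Fin n)) :=
  Module.nontrivial_of_finrank_pos (R := ℝ) (by rw [finrank_euclideanSpace_fin]; exact hn)

theorem isProbabilityMeasure_sphereUniform (hn : 1 ≤ n) :
    IsProbabilityMeasure (sphereUniform n) := by
  have := nontrivial_euclideanSpace hn
  unfold sphereUniform
  have : IsProbabilityMeasure
      (((volume : Measure (EuclideanSpace ℝ (Fin n))).toSphere Set.univ)⁻¹ •
        (volume : Measure (EuclideanSpace ℝ (Fin n))).toSphere) := by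
    refine ⟨?_⟩
    rw [Measure.smul_apply, smul_eq_mul]
    exact ENNReal.inv_mul_cancel (Measure.measure_univ_ne_zero.2 (Measure.toSphere_ne_zero _))
      (measure_ne_top _ _)
  exact Measure.isProbabilityMeasure_map measurable_subtype_coe.aemeasurable

theorem ae_norm_eq_one : ∀ᵐ v ∂(sphereUniform n), ‖v‖ = 1 := by
  unfold sphereUniform
  rw [ae_map_iff measurable_subtype_coe.aemeasurable
    (measurableSet_eq_fun measurable_norm measurable_const)]
  exact Filter.Eventually.of_forall fun v => by simp

theorem integral_sphereUniform (hn : 1 ≤ n) (ψ : EuclideanSpace ℝ (Fin n) → ℝ) :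
    (volume : Measure (EuclideanSpace ℝ (Fin n))).toSphere.real Set.univ *
      ∫ v, ψ v ∂(sphereUniform n) =
    ∫ v : Metric.sphere (0 : EuclideanSpace ℝ (Fin n)) 1, ψ v
      ∂(volume : Measure (EuclideanSpace ℝ (Fin n))).toSphere := by
  have := nontrivial_euclideanSpace hn
  unfold sphereUniform
  rw [(MeasurableEmbedding.subtype_coe (Metric.isClosed_sphere).measurableSet).integral_map,
    integral_smul_measure, ENNReal.toReal_inv, smul_eq_mul, ← mul_assoc, measureReal_def,
    mul_inv_cancel₀, one_mul]
  exact (ENNReal.toReal_pos (Measure.measure_univ_ne_zero.2 (Measure.toSphere_ne_zero _))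
    (measure_ne_top _ _)).ne'

/-- Integration in polar coordinates of a product of a radial and an angular function. -/
theorem integral_radial_mul_angular (hn : 1 ≤ n) (φ : ℝ → ℝ)
    (ψ : EuclideanSpace ℝ (Fin n) → ℝ) :
    ∫ x : EuclideanSpace ℝ (Fin n), φ ‖x‖ * ψ (‖x‖⁻¹ • x) =
      (∫ x : EuclideanSpace ℝ (Fin n), φ ‖x‖) * ∫ v, ψ v ∂(sphereUniform n) := by
  have := nontrivial_euclideanSpace hn
  set μ : Measure (EuclideanSpace ℝ (Fin n)) := volume with hμ
  have key : ∀ ψ : EuclideanSpace ℝ (Fin n) → ℝ,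
      ∫ x : EuclideanSpace ℝ (Fin n), φ ‖x‖ * ψ (‖x‖⁻¹ • x) ∂μ =
      (∫ v : Metric.sphere (0 : EuclideanSpace ℝ (Fin n)) 1, ψ v ∂μ.toSphere) *
        ∫ r : Set.Ioi (0 : ℝ), φ r ∂Measure.volumeIoiPow
          (Module.finrank ℝ (EuclideanSpace ℝ (Fin n)) - 1) := by
    intro ψ
    calc
      _ = ∫ x : ({(0)}ᶜ : Set (EuclideanSpace ℝ (Fin n))),
            φ ‖x.1‖ * ψ (‖x.1‖⁻¹ • x.1) ∂(μ.comap (↑)) := by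
        rw [integral_subtype_comap (measurableSet_singleton _).compl
          fun x => φ ‖x‖ * ψ (‖x‖⁻¹ • x), restrict_compl_singleton]
      _ = ∫ p, ψ (p.1 : EuclideanSpace ℝ (Fin n)) * φ (p.2 : ℝ) ∂μ.toSphere.prod
            (.volumeIoiPow (Module.finrank ℝ (EuclideanSpace ℝ (Fin n)) - 1)) := by
        rw [← μ.measurePreserving_homeomorphUnitSphereProd.integral_comp
          (Homeomorph.measurableEmbedding _)]
        refine integral_congr_ae (Filter.Eventually.of_forall fun x => ?_)
        simp [mul_comm]
      _ = _ := integral_prod_mul (fun v : Metric.sphere (0 : EuclideanSpace ℝ (Fin n)) 1 => ψ v)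
        (fun r : Set.Ioi (0 : ℝ) => φ r)
  have h1 := key fun _ => 1
  simp only [mul_one, integral_const, smul_eq_mul] at h1
  rw [key ψ, h1, ← integral_sphereUniform hn]
  ring

theorem volume_real_ball (hn : 1 ≤ n) {r : ℝ} (hr : 0 ≤ r) :
    (volume : Measure (EuclideanSpace ℝ (Fin n))).real (Metric.ball 0 r) =
      r ^ n * (volume : Measure (EuclideanSpace ℝ (Fin n))).real (Metric.ball 0 1) := by
  have := nontrivial_euclideanSpace hn
  rw [measureReal_def, Measure.addHaar_ball _ _ hr, ENNReal.toReal_mul,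
    ENNReal.toReal_ofReal (by positivity), finrank_euclideanSpace_fin, measureReal_def]

theorem volume_real_ball_one_pos :
    0 < (volume : Measure (EuclideanSpace ℝ (Fin n))).real (Metric.ball 0 1) :=
  ENNReal.toReal_pos (Metric.measure_ball_pos _ _ one_pos).ne' measure_ball_lt_top.ne

theorem integral_sphereUniform_neg (hn : 1 ≤ n) (ψ : EuclideanSpace ℝ (Fin n) → ℝ) :
    ∫ v, ψ (-v) ∂(sphereUniform n) = ∫ v, ψ v ∂(sphereUniform n) := by
  set φ : ℝ → ℝ := (Set.Iio 1).indicator 1 with hφ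
  have hφint : ∫ x : EuclideanSpace ℝ (Fin n), φ ‖x‖ ≠ 0 := by
    have : (fun x : EuclideanSpace ℝ (Fin n) => φ ‖x‖) = (Metric.ball 0 1).indicator 1 := by
      ext x
      simp [hφ, Set.indicator]
    rw [this, integral_indicator_one measurableSet_ball]
    exact volume_real_ball_one_pos.ne'
  refine mul_left_cancel₀ hφint ?_
  rw [← integral_radial_mul_angular hn φ ψ, ← integral_radial_mul_angular hn φ fun v => ψ (-v),
    ← integral_neg_eq_self]
  simp

end Sphere

/-! ### The divergence theorem on the unit ball for Lipschitz functions -/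

section Divergence

variable {n : ℕ}

/-- The radial cutoff equal to `1` on the unit ball, to `0` outside the ball of radius `1 + ε`,
and affine in the norm in between. -/
noncomputable def radialCutoff (n : ℕ) (ε : ℝ) (y : EuclideanSpace ℝ (Fin n)) : ℝ :=
  max 0 (min 1 ((1 + ε - ‖y‖) / ε))

theorem radialCutoff_nonneg (ε : ℝ) (y : EuclideanSpace ℝ (Fin n)) : 0 ≤ radialCutoff n ε y :=
  le_max_left _ _

theorem radialCutoff_le_one (ε : ℝ) (y : EuclideanSpace ℝ (Fin n)) : radialCutoff n ε y ≤ 1 :=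
  max_le zero_le_one (min_le_left _ _)

theorem radialCutoff_eq_one {ε : ℝ} (hε : 0 < ε) {y : EuclideanSpace ℝ (Fin n)} (hy : ‖y‖ ≤ 1) :
    radialCutoff n ε y = 1 := by
  have : 1 ≤ (1 + ε - ‖y‖) / ε := by rw [le_div_iff₀ hε]; linarith
  simp [radialCutoff, this]

theorem radialCutoff_eq_zero {ε : ℝ} (hε : 0 < ε) {y : EuclideanSpace ℝ (Fin n)}
    (hy : 1 + ε ≤ ‖y‖) : radialCutoff n ε y = 0 := by
  have : (1 + ε - ‖y‖) / ε ≤ 0 := div_nonpos_of_nonpos_of_nonneg (by linarith) hε.le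
  rw [radialCutoff, max_eq_left]
  exact (min_le_right _ _).trans this

theorem radialCutoff_eq {ε : ℝ} (hε : 0 < ε) {y : EuclideanSpace ℝ (Fin n)}
    (h1 : 1 ≤ ‖y‖) (h2 : ‖y‖ ≤ 1 + ε) : radialCutoff n ε y = (1 + ε - ‖y‖) / ε := by
  have h3 : (1 + ε - ‖y‖) / ε ≤ 1 := by rw [div_le_iff₀ hε]; linarith
  have h4 : 0 ≤ (1 + ε - ‖y‖) / ε := div_nonneg (by linarith) hε.le
  rw [radialCutoff, min_eq_right h3, max_eq_right h4]

theorem lipschitzWith_radialCutoff {ε : ℝ} (hε : 0 < ε) :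
    LipschitzWith (Real.toNNReal (1 / ε)) (radialCutoff n ε) := by
  have h : LipschitzWith (Real.toNNReal (1 / ε))
      fun y : EuclideanSpace ℝ (Fin n) => (1 + ε - ‖y‖) / ε := by
    refine LipschitzWith.of_dist_le_mul fun x y => ?_
    rw [Real.coe_toNNReal _ (by positivity), Real.dist_eq, dist_eq_norm,
      show (1 + ε - ‖x‖) / ε - (1 + ε - ‖y‖) / ε = (1 / ε) * (‖y‖ - ‖x‖) by ring, abs_mul,
      abs_of_pos (by positivity : 0 < 1 / ε)]
    gcongr
    rw [abs_sub_comm]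
    exact abs_norm_sub_norm_le x y
  exact (h.const_min 1).const_max 0

theorem hasCompactSupport_radialCutoff {ε : ℝ} (hε : 0 < ε) :
    HasCompactSupport (radialCutoff n ε) := by
  refine HasCompactSupport.intro (isCompact_closedBall (0 : EuclideanSpace ℝ (Fin n)) (1 + ε))
    fun y hy => radialCutoff_eq_zero hε ?_
  simp only [Metric.mem_closedBall, dist_zero_right, not_le] at hy
  exact hy.le

theorem hasLineDerivAt_norm {y : EuclideanSpace ℝ (Fin n)} (hy : y ≠ 0)
    (w : EuclideanSpace ℝ (Fin n)) :
    HasLineDerivAt ℝ (fun y : EuclideanSpace ℝ (Fin n) => ‖y‖) (inner ℝ (‖y‖⁻¹ • y) w) y w := by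
  have hy' : ‖y‖ ≠ 0 := norm_ne_zero_iff.2 hy
  have h1 : HasDerivAt (fun t : ℝ => y + t • w) w 0 := by
    simpa using ((hasDerivAt_id (0 : ℝ)).smul_const w).const_add y
  have h2 := (h1.norm_sq).sqrt (by simpa using hy)
  unfold HasLineDerivAt
  convert! h2 using 1
  · ext t
    rw [Real.sqrt_sq (norm_nonneg _)]
  · simp only [zero_smul, add_zero, Real.sqrt_sq (norm_nonneg y), real_inner_smul_left]
    field_simp

theorem lineDeriv_radialCutoff {ε : ℝ} (hε : 0 < ε) {y : EuclideanSpace ℝ (Fin n)}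
    (h1 : ‖y‖ ≠ 1) (h2 : ‖y‖ ≠ 1 + ε) (w : EuclideanSpace ℝ (Fin n)) :
    lineDeriv ℝ (radialCutoff n ε) y (-w) =
      (Set.Ioo 1 (1 + ε)).indicator (fun _ => 1 / ε) ‖y‖ * inner ℝ (‖y‖⁻¹ • y) w := by
  have hc : Tendsto (fun y : EuclideanSpace ℝ (Fin n) => ‖y‖) (𝓝 y) (𝓝 ‖y‖) :=
    continuous_norm.continuousAt
  rcases lt_or_gt_of_ne h1 with h1 | h1
  · have he : radialCutoff n ε =ᶠ[𝓝 y] fun _ => 1 := by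
      filter_upwards [hc.eventually_lt_const h1] with z hz
      exact radialCutoff_eq_one hε hz.le
    rw [he.lineDeriv_eq, Set.indicator_of_notMem (fun h => absurd h.1 h1.le.not_gt)]
    simp [lineDeriv]
  rcases lt_or_gt_of_ne h2 with h2 | h2
  · have he : radialCutoff n ε =ᶠ[𝓝 y] fun z => (1 / ε) • ((1 + ε) - ‖z‖) := by
      filter_upwards [hc.eventually_lt_const h2, hc.eventually_const_lt h1] with z hz hz'
      rw [radialCutoff_eq hε hz'.le hz.le, smul_eq_mul]
      ring
    rw [he.lineDeriv_eq, Set.indicator_of_mem (show ‖y‖ ∈ Set.Ioo 1 (1 + ε) from ⟨h1, h2⟩)]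
    have hy : y ≠ 0 := by
      rintro rfl
      simp at h1
      linarith
    have h3 : HasDerivAt (fun t : ℝ => ‖y + t • (-w)‖) (inner ℝ (‖y‖⁻¹ • y) (-w)) 0 :=
      hasLineDerivAt_norm hy (-w)
    have h4 := (h3.const_sub (1 + ε)).const_mul (1 / ε)
    refine (HasLineDerivAt.lineDeriv (f' := 1 / ε * inner ℝ (‖y‖⁻¹ • y) w) ?_)
    unfold HasLineDerivAt
    simpa [inner_neg_right] using h4
  · have he : radialCutoff n ε =ᶠ[𝓝 y] fun _ => 0 := by
      filter_upwards [hc.eventually_const_lt h2] with z hz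
      exact radialCutoff_eq_zero hε hz.le
    rw [he.lineDeriv_eq, Set.indicator_of_notMem (fun h => absurd h.2 h2.le.not_gt)]
    simp [lineDeriv]

/-- The open shell between the spheres of radii `1` and `1 + ε`. -/
def shell (n : ℕ) (ε : ℝ) : Set (EuclideanSpace ℝ (Fin n)) := {y | ‖y‖ ∈ Set.Ioo 1 (1 + ε)}

theorem measurableSet_shell (ε : ℝ) : MeasurableSet (shell n ε) :=
  measurable_norm measurableSet_Ioo

theorem shell_subset (ε : ℝ) : shell n ε ⊆ Metric.ball 0 (1 + ε) := fun y hy => by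
  simpa using hy.2

theorem volume_shell_ne_top (ε : ℝ) :
    (volume : Measure (EuclideanSpace ℝ (Fin n))) (shell n ε) ≠ ⊤ :=
  ((measure_mono (shell_subset ε)).trans_lt measure_ball_lt_top).ne

theorem volume_real_shell (hn : 1 ≤ n) {ε : ℝ} (hε : 0 < ε) :
    (volume : Measure (EuclideanSpace ℝ (Fin n))).real (shell n ε) =
      ((1 + ε) ^ n - 1) * (volume : Measure (EuclideanSpace ℝ (Fin n))).real (Metric.ball 0 1) := by
  have := nontrivial_euclideanSpace hn
  have h1 : shell n ε = Metric.ball 0 (1 + ε) \ Metric.closedBall 0 1 := by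
    ext y
    simp [shell, and_comm]
  rw [h1, measureReal_sdiff (Metric.closedBall_subset_ball (by linarith))
    measurableSet_closedBall measure_ball_lt_top.ne, volume_real_ball hn (by linarith),
    measureReal_def _ (Metric.closedBall 0 1), Measure.addHaar_closedBall_eq_addHaar_ball,
    ← measureReal_def]
  ring

/-- Divergence theorem on the unit ball, up to the volume of a shell: integration by parts against
the radial cutoff, whose derivative lives on the shell. -/
theorem abs_setIntegral_lineDeriv_sub_le (hn : 1 ≤ n) {C : ℝ≥0}
    {f : EuclideanSpace ℝ (Fin n) → ℝ} (hf : LipschitzWith C f) (w : EuclideanSpace ℝ (Fin n))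
    {ε : ℝ} (hε : 0 < ε) :
    |(∫ y in Metric.closedBall 0 1, lineDeriv ℝ f y w) -
      1 / ε * (volume : Measure (EuclideanSpace ℝ (Fin n))).real (shell n ε) *
        ∫ v, inner ℝ v w * f v ∂(sphereUniform n)| ≤
      2 * C * ‖w‖ * (volume : Measure (EuclideanSpace ℝ (Fin n))).real (shell n ε) := by
  classical
  have := nontrivial_euclideanSpace hn
  set B : Set (EuclideanSpace ℝ (Fin n)) := Metric.closedBall 0 1
  set S := shell n ε with hS
  have hSm : MeasurableSet S := measurableSet_shell ε
  have hae : ∀ᵐ y : EuclideanSpace ℝ (Fin n), ‖y‖ ≠ 1 ∧ ‖y‖ ≠ 1 + ε := by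
    have h1 : ∀ r : ℝ, ∀ᵐ y : EuclideanSpace ℝ (Fin n), ‖y‖ ≠ r := fun r => by
      have := Measure.addHaar_sphere (volume : Measure (EuclideanSpace ℝ (Fin n))) 0 r
      rw [measure_eq_zero_iff_ae_notMem] at this
      simpa using this
    exact (h1 1).and (h1 (1 + ε))
  have hdm : Measurable fun y => lineDeriv ℝ f y w := measurable_lineDeriv hf.continuous
  have hdb : ∀ y, ‖lineDeriv ℝ f y w‖ ≤ C * ‖w‖ := fun y => norm_lineDeriv_le_of_lipschitz ℝ hf
  have hgc : Continuous (radialCutoff n ε) := (lipschitzWith_radialCutoff hε).continuous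
  have hdgb : ∀ y, ‖lineDeriv ℝ f y w * radialCutoff n ε y‖ ≤ C * ‖w‖ := fun y => by
    rw [norm_mul]
    refine (mul_le_of_le_one_right (norm_nonneg _) ?_).trans (hdb y)
    rw [Real.norm_of_nonneg (radialCutoff_nonneg ε y)]
    exact radialCutoff_le_one ε y
  have hint : ∀ s : Set (EuclideanSpace ℝ (Fin n)), volume s ≠ ⊤ →
      IntegrableOn (fun y => lineDeriv ℝ f y w * radialCutoff n ε y) s := fun s hs =>
    Measure.integrableOn_of_bounded hs (hdm.mul hgc.measurable).aestronglyMeasurable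
      (Eventually.of_forall hdgb)
  -- The left-hand side of the integration by parts formula.
  have hL : ∫ y, lineDeriv ℝ f y w * radialCutoff n ε y =
      (∫ y in B, lineDeriv ℝ f y w) + ∫ y in S, lineDeriv ℝ f y w * radialCutoff n ε y := by
    have h1 : ∫ y, lineDeriv ℝ f y w * radialCutoff n ε y =
        ∫ y in B ∪ S, lineDeriv ℝ f y w * radialCutoff n ε y := by
      rw [← integral_indicator (measurableSet_closedBall.union hSm)]
      refine integral_congr_ae ?_
      filter_upwards [hae] with y hy
      rw [Set.indicator_apply]
      split_ifs with h
      · rfl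
      · rw [radialCutoff_eq_zero hε, mul_zero]
        by_contra! hlt
        refine h ?_
        by_cases hy1 : ‖y‖ ≤ 1
        · exact Or.inl (by simpa [B] using hy1)
        · exact Or.inr ⟨not_le.1 hy1, hlt⟩
    rw [h1, setIntegral_union _ hSm (hint _ measure_closedBall_lt_top.ne)
      (hint _ (volume_shell_ne_top ε))]
    · congr 1
      refine setIntegral_congr_fun measurableSet_closedBall fun y hy => ?_
      rw [radialCutoff_eq_one hε (by simpa [B] using hy), mul_one]
    · rw [Set.disjoint_left]
      intro y hy hy'
      have h2 : ‖y‖ ≤ 1 := by simpa [B] using hy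
      exact absurd hy'.1 h2.not_gt
  have hproj : ∀ y : EuclideanSpace ℝ (Fin n), ‖‖y‖⁻¹ • y‖ ≤ 1 := fun y => by
    rw [norm_smul, norm_inv, norm_norm]
    exact inv_mul_le_one
  have hinner : ∀ y : EuclideanSpace ℝ (Fin n), |inner ℝ (‖y‖⁻¹ • y) w| ≤ ‖w‖ := fun y =>
    (abs_real_inner_le_norm _ _).trans (mul_le_of_le_one_left (norm_nonneg _) (hproj y))
  have hnm : Measurable fun y : EuclideanSpace ℝ (Fin n) => ‖y‖⁻¹ • y :=
    measurable_norm.inv.smul measurable_id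
  have him : Measurable fun y : EuclideanSpace ℝ (Fin n) => (inner ℝ (‖y‖⁻¹ • y) w : ℝ) :=
    (continuous_id.inner continuous_const).measurable.comp hnm
  have hdiff : ∀ y ∈ S, |f y - f (‖y‖⁻¹ • y)| ≤ C * ε := fun y hy => by
    have hy1 : 1 < ‖y‖ := hy.1
    have hy2 : ‖y‖ < 1 + ε := hy.2
    have h1 := hf.dist_le_mul y (‖y‖⁻¹ • y)
    rw [Real.dist_eq] at h1
    refine h1.trans (mul_le_mul_of_nonneg_left ?_ C.2)
    have h2 : y - ‖y‖⁻¹ • y = (1 - ‖y‖⁻¹) • y := by rw [sub_smul, one_smul]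
    have h3 : ‖y‖⁻¹ ≤ 1 := inv_le_one_of_one_le₀ hy1.le
    rw [dist_eq_norm, h2, norm_smul, Real.norm_of_nonneg (by linarith), sub_mul,
      inv_mul_cancel₀ (by linarith)]
    linarith
  -- The right-hand side of the integration by parts formula.
  have hR : ∫ y, lineDeriv ℝ (radialCutoff n ε) y (-w) * f y =
      1 / ε * volume.real S * (∫ v, inner ℝ v w * f v ∂(sphereUniform n)) +
        ∫ y in S, 1 / ε * inner ℝ (‖y‖⁻¹ • y) w * (f y - f (‖y‖⁻¹ • y)) := by
    have h1 : ∫ y, lineDeriv ℝ (radialCutoff n ε) y (-w) * f y =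
        ∫ y in S, 1 / ε * inner ℝ (‖y‖⁻¹ • y) w * f y := by
      rw [← integral_indicator hSm]
      refine integral_congr_ae ?_
      filter_upwards [hae] with y hy
      rw [lineDeriv_radialCutoff hε hy.1 hy.2]
      by_cases h : y ∈ S
      · rw [Set.indicator_of_mem h, Set.indicator_of_mem (show ‖y‖ ∈ Set.Ioo 1 (1 + ε) from h)]
      · rw [Set.indicator_of_notMem h,
          Set.indicator_of_notMem (show ‖y‖ ∉ Set.Ioo 1 (1 + ε) from h)]
        simp
    have h2 : 1 / ε * volume.real S * (∫ v, inner ℝ v w * f v ∂(sphereUniform n)) =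
        ∫ y in S, 1 / ε * inner ℝ (‖y‖⁻¹ • y) w * f (‖y‖⁻¹ • y) := by
      have h3 := integral_radial_mul_angular hn ((Set.Ioo 1 (1 + ε)).indicator fun _ => 1 / ε)
        fun v => inner ℝ v w * f v
      have h4 : ∫ x : EuclideanSpace ℝ (Fin n), (Set.Ioo 1 (1 + ε)).indicator (fun _ => 1 / ε) ‖x‖
          = 1 / ε * volume.real S := by
        have : (fun x : EuclideanSpace ℝ (Fin n) =>
            (Set.Ioo 1 (1 + ε)).indicator (fun _ => 1 / ε) ‖x‖) = S.indicator fun _ => 1 / ε := rfl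
        rw [this, integral_indicator hSm, setIntegral_const, smul_eq_mul, mul_comm]
      rw [h4] at h3
      rw [← h3, ← integral_indicator hSm]
      refine integral_congr_ae (Eventually.of_forall fun y => ?_)
      simp only
      by_cases h : y ∈ S
      · rw [Set.indicator_of_mem h, Set.indicator_of_mem (show ‖y‖ ∈ Set.Ioo 1 (1 + ε) from h)]
        ring
      · rw [Set.indicator_of_notMem h,
          Set.indicator_of_notMem (show ‖y‖ ∉ Set.Ioo 1 (1 + ε) from h), zero_mul]
    have hSb : volume S ≠ ⊤ := volume_shell_ne_top ε
    have hbd : ∀ y ∈ Metric.ball (0 : EuclideanSpace ℝ (Fin n)) (1 + ε),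
        |f y| ≤ |f 0| + C * (1 + ε) := fun y hy => by
      have h1 := hf.dist_le_mul y 0
      rw [Real.dist_eq, dist_zero_right] at h1
      have h2 : ‖y‖ ≤ 1 + ε := by simpa using (Metric.mem_ball.1 hy).le
      have h3 := mul_le_mul_of_nonneg_left h2 C.2
      have h4 := abs_sub_abs_le_abs_sub (f y) (f 0)
      change (C : ℝ) * ‖y‖ ≤ C * (1 + ε) at h3
      linarith
    have hi : ∀ g : EuclideanSpace ℝ (Fin n) → EuclideanSpace ℝ (Fin n), Measurable g →
        (∀ y ∈ S, g y ∈ Metric.ball 0 (1 + ε)) →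
        IntegrableOn (fun y => 1 / ε * inner ℝ (‖y‖⁻¹ • y) w * f (g y)) S := by
      intro g hg hgS
      refine Measure.integrableOn_of_bounded (M := 1 / ε * ‖w‖ * (|f 0| + C * (1 + ε))) hSb
        ((him.const_mul _).mul (hf.continuous.measurable.comp hg)).aestronglyMeasurable ?_
      refine (ae_restrict_iff' hSm).2 (Eventually.of_forall fun y hy => ?_)
      rw [norm_mul, norm_mul, Real.norm_of_nonneg (by positivity : 0 ≤ 1 / ε), Real.norm_eq_abs,
        Real.norm_eq_abs]
      gcongr
      · exact hinner y
      · exact hbd _ (hgS y hy)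
    rw [h1, h2, ← integral_add (hi _ hnm fun y hy => ?_)]
    · refine integral_congr_ae (Eventually.of_forall fun y => ?_)
      simp only
      ring
    · have h5 := (hi id measurable_id fun y hy => shell_subset ε hy).sub (hi _ hnm fun y hy => ?_)
      · refine h5.congr (Eventually.of_forall fun y => ?_)
        simp [mul_sub]
      · simpa using (hproj y).trans_lt (by linarith)
    · simpa using (hproj y).trans_lt (by linarith)
  have hparts := hf.integral_lineDeriv_mul_eq (μ := volume) (lipschitzWith_radialCutoff hε)
    (hasCompactSupport_radialCutoff hε) w
  rw [hL, hR] at hparts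
  have e1 : ‖∫ y in S, lineDeriv ℝ f y w * radialCutoff n ε y‖ ≤ C * ‖w‖ * volume.real S :=
    norm_setIntegral_le_of_norm_le_const (volume_shell_ne_top ε).lt_top fun y _ => hdgb y
  have e2 : ‖∫ y in S, 1 / ε * inner ℝ (‖y‖⁻¹ • y) w * (f y - f (‖y‖⁻¹ • y))‖ ≤
      C * ‖w‖ * volume.real S := by
    refine norm_setIntegral_le_of_norm_le_const (volume_shell_ne_top ε).lt_top fun y hy => ?_
    rw [norm_mul, norm_mul, Real.norm_of_nonneg (by positivity : 0 ≤ 1 / ε), Real.norm_eq_abs,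
      Real.norm_eq_abs]
    calc _ ≤ 1 / ε * ‖w‖ * (C * ε) := by
          gcongr
          · exact hinner y
          · exact hdiff y hy
      _ = C * ‖w‖ := by field_simp
  rw [Real.norm_eq_abs, abs_le] at e1 e2
  rw [abs_le]
  constructor <;> linarith [hparts, e1.1, e1.2, e2.1, e2.2]

/-- Divergence theorem on the unit ball for a Lipschitz function: the mean of the derivative in
direction `w` over the ball is `n` times the mean of `⟪v, w⟫ f v` over the sphere. -/
theorem setIntegral_lineDeriv_closedBall (hn : 1 ≤ n) {C : ℝ≥0}
    {f : EuclideanSpace ℝ (Fin n) → ℝ} (hf : LipschitzWith C f) (w : EuclideanSpace ℝ (Fin n)) :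
    ∫ y in Metric.closedBall 0 1, lineDeriv ℝ f y w =
      n * (volume : Measure (EuclideanSpace ℝ (Fin n))).real (Metric.ball 0 1) *
        ∫ v, inner ℝ v w * f v ∂(sphereUniform n) := by
  set V := (volume : Measure (EuclideanSpace ℝ (Fin n))).real (Metric.ball 0 1) with hV
  set I := ∫ y in Metric.closedBall 0 1, lineDeriv ℝ f y w
  set J := ∫ v, inner ℝ v w * f v ∂(sphereUniform n)
  have hd : HasDerivAt (fun ε : ℝ => (1 + ε) ^ n) n 0 := by
    simpa using ((hasDerivAt_id (0 : ℝ)).const_add 1).fun_pow n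
  have ht := hd.tendsto_slope_zero_right
  have h1 : Tendsto (fun ε : ℝ => |I - 1 / ε * volume.real (shell n ε) * J|) (𝓝[>] 0)
      (𝓝 |I - n * V * J|) := by
    refine (Tendsto.const_sub I ?_).abs
    refine ((ht.mul_const V).mul_const J).congr' ?_
    filter_upwards [self_mem_nhdsWithin] with ε hε
    rw [volume_real_shell hn hε, ← hV]
    simp only [smul_eq_mul, zero_add, add_zero, one_pow]
    ring
  have h2 : Tendsto (fun ε : ℝ => 2 * C * ‖w‖ * (volume : Measure (EuclideanSpace ℝ (Fin n))).real
      (shell n ε)) (𝓝[>] 0) (𝓝 0) := by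
    have h3 : Tendsto (fun ε : ℝ => 2 * C * ‖w‖ * (((1 + ε) ^ n - 1) * V)) (𝓝[>] 0) (𝓝 0) := by
      have : Continuous fun ε : ℝ => 2 * C * ‖w‖ * (((1 + ε) ^ n - 1) * V) := by fun_prop
      have h4 := this.tendsto 0
      simp only [add_zero, one_pow, sub_self, zero_mul, mul_zero] at h4
      exact h4.mono_left nhdsWithin_le_nhds
    refine h3.congr' ?_
    filter_upwards [self_mem_nhdsWithin] with ε hε
    rw [volume_real_shell hn hε]
  have h3 : |I - n * V * J| ≤ 0 := by
    refine le_of_tendsto_of_tendsto h1 h2 ?_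
    filter_upwards [self_mem_nhdsWithin] with ε hε
    exact abs_setIntegral_lineDeriv_sub_le hn hf w hε
  linarith [abs_nonpos_iff.1 h3]

end Divergence

/-! ### The standard Gaussian measure -/

section Gaussian

variable {n : ℕ}

theorem stdGaussian_eq_withDensity :
    ∃ c : ℝ, 0 < c ∧ stdGaussian (EuclideanSpace ℝ (Fin n)) =
      volume.withDensity fun x => ENNReal.ofReal (c * Real.exp (-‖x‖ ^ 2 / 2)) := by
  have hint : Integrable fun x : EuclideanSpace ℝ (Fin n) => Real.exp (-‖x‖ ^ 2 / 2) := by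
    have := (GaussianFourier.integrable_cexp_neg_mul_sq_norm_add (b := 1 / 2) (by norm_num) 0
      (0 : EuclideanSpace ℝ (Fin n))).norm
    refine this.congr (Eventually.of_forall fun x => ?_)
    simp only [Complex.norm_exp]
    congr 1
    simp [← Complex.ofReal_pow]
    ring
  set Z : ℝ := (2 * Real.pi) ^ ((n : ℝ) / 2) with hZ
  have hZpos : 0 < Z := by positivity
  refine ⟨Z⁻¹, by positivity, ?_⟩
  have : IsFiniteMeasure ((volume : Measure (EuclideanSpace ℝ (Fin n))).withDensity
      fun x => ENNReal.ofReal (Z⁻¹ * Real.exp (-‖x‖ ^ 2 / 2))) :=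
    isFiniteMeasure_withDensity_ofReal (hint.const_mul _).2
  refine Measure.ext_of_charFun ?_
  ext t
  rw [charFun_stdGaussian, charFun_apply, integral_withDensity_eq_integral_toReal_smul₀
    (by fun_prop) (by simp)]
  have h1 : ∀ x : EuclideanSpace ℝ (Fin n),
      (ENNReal.ofReal (Z⁻¹ * Real.exp (-‖x‖ ^ 2 / 2))).toReal •
        Complex.exp (inner ℝ x t * Complex.I) =
        (Z : ℂ)⁻¹ * Complex.exp (-(1 / 2 : ℂ) * ‖x‖ ^ 2 + Complex.I * inner ℝ t x) := by
    intro x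
    rw [ENNReal.toReal_ofReal (by positivity), Complex.exp_add, real_inner_comm, Complex.real_smul]
    push_cast
    rw [mul_assoc, mul_comm (Complex.I)]
    congr 3
    ring
  simp_rw [h1]
  rw [integral_const_mul, GaussianFourier.integral_cexp_neg_mul_sq_norm_add (by norm_num)]
  have h2 : ((Real.pi : ℂ) / (1 / 2)) ^ ((Module.finrank ℝ (EuclideanSpace ℝ (Fin n)) : ℂ) / 2) =
      (Z : ℂ) := by
    rw [hZ, Complex.ofReal_cpow (by positivity)]
    simp only [finrank_euclideanSpace_fin]
    push_cast
    congr 1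
    ring
  rw [h2, ← mul_assoc, inv_mul_cancel₀ (by exact_mod_cast hZpos.ne'), one_mul, Complex.I_sq]
  congr 1
  ring

theorem stdGaussian_absolutelyContinuous :
    stdGaussian (EuclideanSpace ℝ (Fin n)) ≪ volume := by
  obtain ⟨c, -, h⟩ := stdGaussian_eq_withDensity (n := n)
  rw [h]
  exact withDensity_absolutelyContinuous _ _

theorem integral_sq_strongDual_stdGaussian
    (A : StrongDual ℝ (EuclideanSpace ℝ (Fin n))) :
    ∫ x, (A x) ^ 2 ∂(stdGaussian (EuclideanSpace ℝ (Fin n))) = ‖A‖ ^ 2 := by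
  rw [← variance_dual_stdGaussian, variance_of_integral_eq_zero
    A.continuous.aemeasurable (integral_strongDual_stdGaussian A)]

theorem memLp_norm_stdGaussian :
    MemLp (fun x => ‖x‖) 2 (stdGaussian (EuclideanSpace ℝ (Fin n))) :=
  (IsGaussian.memLp_id _ 2 (by simp)).norm

theorem integral_sq_norm_stdGaussian :
    ∫ x, ‖x‖ ^ 2 ∂(stdGaussian (EuclideanSpace ℝ (Fin n))) = n := by
  have h1 : ∀ x : EuclideanSpace ℝ (Fin n), ‖x‖ ^ 2 =
      ∑ i, (innerSL ℝ (EuclideanSpace.single i (1 : ℝ)) x) ^ 2 := fun x => by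
    simp [EuclideanSpace.norm_sq_eq, innerSL_apply_apply, EuclideanSpace.inner_single_left]
  simp_rw [h1]
  rw [integral_finsetSum]
  · simp_rw [integral_sq_strongDual_stdGaussian]
    simp
  · intro i _
    refine MemLp.integrable_sq ?_
    exact (innerSL ℝ (EuclideanSpace.single i (1 : ℝ))).comp_memLp'
      (IsGaussian.memLp_id _ 2 (by simp))

/-- The Gaussian vector has a uniform direction: integrals against the Gaussian measure of
functions homogeneous of degree two. -/
theorem integral_sq_norm_mul_stdGaussian (hn : 1 ≤ n) (ψ : EuclideanSpace ℝ (Fin n) → ℝ) :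
    ∫ x, ‖x‖ ^ 2 * ψ (‖x‖⁻¹ • x) ∂(stdGaussian (EuclideanSpace ℝ (Fin n))) =
      n * ∫ v, ψ v ∂(sphereUniform n) := by
  have h0 := integral_sq_norm_stdGaussian (n := n)
  obtain ⟨c, hc, h⟩ := stdGaussian_eq_withDensity (n := n)
  have key : ∀ g : EuclideanSpace ℝ (Fin n) → ℝ,
      ∫ x, g x ∂(stdGaussian (EuclideanSpace ℝ (Fin n))) =
        ∫ x, c * Real.exp (-‖x‖ ^ 2 / 2) * g x := fun g => by
    rw [h, integral_withDensity_eq_integral_toReal_smul₀ (by fun_prop) (by simp)]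
    refine integral_congr_ae (Eventually.of_forall fun x => ?_)
    simp only
    rw [ENNReal.toReal_ofReal (by positivity), smul_eq_mul]
  rw [key] at h0 ⊢
  have h2 := integral_radial_mul_angular hn (fun r => c * Real.exp (-r ^ 2 / 2) * r ^ 2) ψ
  simp only [h0] at h2
  rw [← h2]
  refine integral_congr_ae (Eventually.of_forall fun x => ?_)
  simp only
  ring

end Gaussian

/-! ### The Poincaré inequality for odd Lipschitz functions -/

section Poincare

variable {n : ℕ}

theorem norm_rotate_sub_le (s : ℝ) (hs : 0 ≤ s) (a b : EuclideanSpace ℝ (Fin n)) :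
    ‖(Real.cos s • a + Real.sin s • b) - a‖ ≤ s * (‖a‖ + ‖b‖) := by
  have h1 : |Real.cos s - 1| ≤ s := by
    have := Real.abs_cos_sub_cos_le s 0
    simpa [abs_of_nonneg hs] using this
  have h2 : |Real.sin s| ≤ s := by
    have := Real.abs_sin_le_abs (x := s)
    rwa [abs_of_nonneg hs] at this
  calc _ = ‖(Real.cos s - 1) • a + Real.sin s • b‖ := by congr 1; module
    _ ≤ |Real.cos s - 1| * ‖a‖ + |Real.sin s| * ‖b‖ := by
      refine (norm_add_le _ _).trans ?_
      rw [norm_smul, norm_smul, Real.norm_eq_abs, Real.norm_eq_abs]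
    _ ≤ s * ‖a‖ + s * ‖b‖ := by gcongr
    _ = _ := by ring

theorem integrable_sq_norm_add_norm_stdGaussian_prod :
    Integrable (fun p : EuclideanSpace ℝ (Fin n) × EuclideanSpace ℝ (Fin n) =>
      (‖p.1‖ + ‖p.2‖) ^ 2) ((stdGaussian (EuclideanSpace ℝ (Fin n))).prod
        (stdGaussian (EuclideanSpace ℝ (Fin n)))) :=
  ((memLp_norm_stdGaussian.comp_fst _).add (memLp_norm_stdGaussian.comp_snd _)).integrable_sq

/-- The half turn from `p.1` to `-p.1` in the plane of the two coordinates is cut into `N + 1` equal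
rotations. By the Cauchy-Schwarz inequality and rotation invariance, the total change `2 f` is
controlled by the change along the first of them. -/
theorem integral_sq_odd_le_of_rotation {ℓ : ℝ≥0} {f : EuclideanSpace ℝ (Fin n) → ℝ}
    (hf : LipschitzWith ℓ f) (hodd : ∀ x, f (-x) = -f x) (N : ℕ) :
    4 * ∫ x, f x ^ 2 ∂(stdGaussian (EuclideanSpace ℝ (Fin n))) ≤
      ∫ p, ((N + 1 : ℝ) * (f (Real.cos (Real.pi / (N + 1)) • p.1 +
        Real.sin (Real.pi / (N + 1)) • p.2) - f p.1)) ^ 2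
        ∂((stdGaussian (EuclideanSpace ℝ (Fin n))).prod
          (stdGaussian (EuclideanSpace ℝ (Fin n)))) := by
  set γ := stdGaussian (EuclideanSpace ℝ (Fin n)) with hγ
  set δ : ℝ := Real.pi / (N + 1) with hδ
  have hδ0 : 0 ≤ δ := by positivity
  set φ : ℕ → EuclideanSpace ℝ (Fin n) × EuclideanSpace ℝ (Fin n) → ℝ :=
    fun j p => f (Real.cos (j * δ) • p.1 + Real.sin (j * δ) • p.2) with hφ
  set h : EuclideanSpace ℝ (Fin n) × EuclideanSpace ℝ (Fin n) → ℝ :=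
    fun p => (f (Real.cos δ • p.1 + Real.sin δ • p.2) - f p.1) ^ 2 with hh
  have hfc := hf.continuous
  have hhc : Continuous h := by fun_prop
  have hhi : Integrable h (γ.prod γ) := by
    refine (integrable_sq_norm_add_norm_stdGaussian_prod.const_mul ((ℓ * δ) ^ 2)).mono'
      hhc.aestronglyMeasurable (Eventually.of_forall fun p => ?_)
    rw [Real.norm_of_nonneg (sq_nonneg _), ← mul_pow, ← sq_abs]
    gcongr
    have := hf.dist_le_mul (Real.cos δ • p.1 + Real.sin δ • p.2) p.1
    rw [Real.dist_eq, dist_eq_norm] at this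
    refine this.trans ?_
    rw [mul_assoc]
    gcongr
    exact norm_rotate_sub_le δ hδ0 p.1 p.2
  have hrot : ∀ j, MeasurePreserving (ContinuousLinearMap.rotation (E := EuclideanSpace ℝ (Fin n))
      (j * δ)) (γ.prod γ) (γ.prod γ) := fun j =>
    ⟨(ContinuousLinearMap.rotation _).continuous.measurable,
      IsGaussian.map_rotation_eq_self integral_id_stdGaussian _⟩
  have hcomp : ∀ j : ℕ, ∀ p, (φ j p - φ (j + 1) p) ^ 2 =
      h (ContinuousLinearMap.rotation (j * δ) p) := by
    intro j p
    simp only [hφ, hh, ContinuousLinearMap.rotation_apply]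
    rw [← neg_sq, neg_sub]
    congr 3
    rw [Nat.cast_succ, add_mul, one_mul, Real.cos_add, Real.sin_add]
    module
  have hint : ∀ j : ℕ, Integrable (fun p => (φ j p - φ (j + 1) p) ^ 2) (γ.prod γ) := fun j => by
    simp_rw [hcomp j]
    exact (hrot j).integrable_comp_of_integrable hhi
  have hval : ∀ j : ℕ, ∫ p, (φ j p - φ (j + 1) p) ^ 2 ∂(γ.prod γ) = ∫ p, h p ∂(γ.prod γ) := by
    intro j
    simp_rw [hcomp j]
    rw [← integral_map (hrot j).measurable.aemeasurable, (hrot j).map_eq]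
    exact hhc.aestronglyMeasurable
  have hpt : ∀ p, 4 * f p.1 ^ 2 ≤
      (N + 1 : ℝ) * ∑ j ∈ Finset.range (N + 1), (φ j p - φ (j + 1) p) ^ 2 := by
    intro p
    have h1 : φ 0 p - φ (N + 1) p = 2 * f p.1 := by
      have : ((N : ℝ) + 1) * δ = Real.pi := by rw [hδ]; field_simp
      simp only [hφ, Nat.cast_zero, zero_mul, Real.cos_zero, Real.sin_zero, one_smul, zero_smul,
        add_zero, Nat.cast_succ, this, Real.cos_pi, Real.sin_pi, neg_smul, hodd]
      ring
    have h2 := sq_sum_le_card_mul_sum_sq (s := Finset.range (N + 1))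
      (f := fun j => φ j p - φ (j + 1) p)
    rw [Finset.sum_range_sub', h1] at h2
    simp only [Finset.card_range, Nat.cast_succ] at h2
    linarith
  calc 4 * ∫ x, f x ^ 2 ∂γ = ∫ p, 4 * f p.1 ^ 2 ∂(γ.prod γ) := by
        rw [integral_const_mul, integral_fun_fst (fun x => f x ^ 2)]
        simp
    _ ≤ ∫ p, (N + 1 : ℝ) * ∑ j ∈ Finset.range (N + 1), (φ j p - φ (j + 1) p) ^ 2 ∂(γ.prod γ) := by
        refine integral_mono_of_nonneg (Eventually.of_forall fun p => by positivity)
          ((integrable_finsetSum _ fun j _ => hint j).const_mul _) (Eventually.of_forall hpt)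
    _ = _ := by
        rw [integral_const_mul, integral_finsetSum _ fun j _ => hint j]
        simp only [hval, Finset.sum_const, Finset.card_range, nsmul_eq_mul, mul_pow]
        rw [integral_const_mul, Nat.cast_succ, ← mul_assoc, sq]

/-- Gaussian Poincaré inequality for an odd Lipschitz function. The vector `X` is turned into `-X`
through `cos s • X + sin s • Y` with an independent copy `Y`; by rotation invariance, equal
steps contribute equally, and small steps are governed by the derivative of `f` along `Y`. -/
theorem integral_sq_odd_le {ℓ : ℝ≥0} {f : EuclideanSpace ℝ (Fin n) → ℝ}
    (hf : LipschitzWith ℓ f) (hodd : ∀ x, f (-x) = -f x) :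
    4 * ∫ x, f x ^ 2 ∂(stdGaussian (EuclideanSpace ℝ (Fin n))) ≤ (Real.pi * ℓ) ^ 2 := by
  set γ := stdGaussian (EuclideanSpace ℝ (Fin n)) with hγ
  have hfc := hf.continuous
  have hfd : Measurable (fderiv ℝ f) := measurable_fderiv ℝ f
  set F' : EuclideanSpace ℝ (Fin n) × EuclideanSpace ℝ (Fin n) → ℝ :=
    fun p => (Real.pi * fderiv ℝ f p.1 p.2) ^ 2 with hF'
  have hF'm : Measurable F' := by
    have : Measurable fun p : EuclideanSpace ℝ (Fin n) × EuclideanSpace ℝ (Fin n) =>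
        fderiv ℝ f p.1 p.2 :=
      (isBoundedBilinearMap_apply (𝕜 := ℝ)).continuous.measurable.comp
        ((hfd.comp measurable_fst).prodMk measurable_snd)
    exact (this.const_mul _).pow_const 2
  have hbound := integrable_sq_norm_add_norm_stdGaussian_prod (n := n).const_mul
    ((ℓ * Real.pi) ^ 2)
  have hlim : Tendsto (fun N : ℕ => ∫ p, ((N + 1 : ℝ) * (f (Real.cos (Real.pi / (N + 1)) • p.1 +
        Real.sin (Real.pi / (N + 1)) • p.2) - f p.1)) ^ 2 ∂(γ.prod γ)) atTop
      (𝓝 (∫ p, F' p ∂(γ.prod γ))) := by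
    refine tendsto_integral_of_dominated_convergence _
      (fun N => (by fun_prop : Continuous fun p : EuclideanSpace ℝ (Fin n) ×
        EuclideanSpace ℝ (Fin n) => ((N + 1 : ℝ) * (f (Real.cos (Real.pi / (N + 1)) • p.1 +
        Real.sin (Real.pi / (N + 1)) • p.2) - f p.1)) ^ 2).aestronglyMeasurable)
      hbound (fun N => Eventually.of_forall fun p => ?_) ?_
    · rw [Real.norm_of_nonneg (sq_nonneg _), ← mul_pow, ← sq_abs, abs_mul,
        abs_of_nonneg (by positivity : (0 : ℝ) ≤ N + 1)]
      refine pow_le_pow_left₀ (by positivity) ?_ 2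
      have := hf.dist_le_mul (Real.cos (Real.pi / (N + 1)) • p.1 +
        Real.sin (Real.pi / (N + 1)) • p.2) p.1
      rw [Real.dist_eq, dist_eq_norm] at this
      calc _ ≤ (N + 1 : ℝ) * (ℓ * (Real.pi / (N + 1) * (‖p.1‖ + ‖p.2‖))) := by
            refine mul_le_mul_of_nonneg_left (this.trans ?_) (by positivity)
            gcongr
            exact norm_rotate_sub_le _ (by positivity) p.1 p.2
        _ = _ := by field_simp
    · have hd : ∀ᵐ p ∂(γ.prod γ), DifferentiableAt ℝ f p.1 :=
        Measure.quasiMeasurePreserving_fst.ae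
          (stdGaussian_absolutelyContinuous.ae_le hf.ae_differentiableAt)
      filter_upwards [hd] with p hp
      have h1 : HasDerivAt (fun s : ℝ => Real.cos s • p.1 + Real.sin s • p.2) p.2 0 := by
        simpa using ((Real.hasDerivAt_cos 0).smul_const p.1).fun_add
          ((Real.hasDerivAt_sin 0).smul_const p.2)
      have h2 : HasDerivAt (fun s : ℝ => f (Real.cos s • p.1 + Real.sin s • p.2))
          (fderiv ℝ f p.1 p.2) 0 := by
        refine HasFDerivAt.comp_hasDerivAt (0 : ℝ) (l := f) ?_ h1
        simpa using hp.hasFDerivAt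
      have h3 := h2.tendsto_slope_zero
      have h4 : Tendsto (fun N : ℕ => Real.pi / ((N : ℝ) + 1)) atTop (𝓝[≠] 0) := by
        refine tendsto_nhdsWithin_iff.2 ⟨?_, Eventually.of_forall fun N => ?_⟩
        · have := (tendsto_one_div_add_atTop_nhds_zero_nat (𝕜 := ℝ)).const_mul Real.pi
          simpa [div_eq_mul_inv] using this
        · have : Real.pi / ((N : ℝ) + 1) ≠ 0 := by positivity
          exact this
      have h5 := ((h3.comp h4).const_mul Real.pi).pow 2
      refine h5.congr fun N => ?_
      simp only [Function.comp, zero_add, Real.cos_zero, Real.sin_zero, one_smul, zero_smul,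
        add_zero, smul_eq_mul]
      have : Real.pi ≠ 0 := Real.pi_ne_zero
      congr 1
      field_simp
  refine (ge_of_tendsto' hlim fun N => integral_sq_odd_le_of_rotation hf hodd N).trans ?_
  have hnorm : ∀ x, ‖fderiv ℝ f x‖ ≤ ℓ := fun x => norm_fderiv_le_of_lipschitz ℝ hf
  have hF'i : Integrable F' (γ.prod γ) := by
    refine hbound.mono' hF'm.aestronglyMeasurable (Eventually.of_forall fun p => ?_)
    rw [Real.norm_of_nonneg (sq_nonneg _), ← mul_pow, ← sq_abs, abs_mul, abs_of_pos Real.pi_pos,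
      mul_comm (ℓ : ℝ), mul_assoc]
    gcongr
    refine (ContinuousLinearMap.le_opNorm (fderiv ℝ f p.1) p.2).trans ?_
    gcongr
    · exact hnorm p.1
    · linarith [norm_nonneg p.1]
  rw [integral_prod _ hF'i]
  have h6 : ∀ x, ∫ y, F' (x, y) ∂γ ≤ (Real.pi * ℓ) ^ 2 := fun x => by
    simp only [hF', mul_pow]
    rw [integral_const_mul, integral_sq_strongDual_stdGaussian]
    gcongr
    exact hnorm x
  calc _ ≤ ∫ _, (Real.pi * ℓ) ^ 2 ∂γ :=
        integral_mono_of_nonneg (Eventually.of_forall fun x => integral_nonneg fun y => sq_nonneg _)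
          (integrable_const _) (Eventually.of_forall h6)
    _ = _ := by simp

end Poincare

/-! ### Admissible constants in the second moment estimate -/

section DifferenceConstant

variable {n : ℕ}

theorem integrable_sphereUniform_of_continuous (hn : 1 ≤ n) {H : Type*} [NormedAddCommGroup H]
    {f : EuclideanSpace ℝ (Fin n) → H} (hf : Continuous f) :
    Integrable f (sphereUniform n) := by
  have := isProbabilityMeasure_sphereUniform hn
  obtain ⟨M, hM⟩ := (isCompact_sphere (0 : EuclideanSpace ℝ (Fin n)) 1).exists_bound_of_continuousOn
    hf.continuousOn
  refine Integrable.of_bound hf.aestronglyMeasurable M ?_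
  filter_upwards [ae_norm_eq_one] with v hv
  exact hM v (by simpa using hv)

theorem abs_difference_quotient_le {L : ℝ≥0} {F : EuclideanSpace ℝ (Fin n) → ℝ}
    (hF : LipschitzWith L F) {h : ℝ} (hh : 0 < h) (x v : EuclideanSpace ℝ (Fin n)) :
    |1 / (2 * h) * (F (x + h • v) - F (x - h • v))| ≤ L * ‖v‖ := by
  have h1 := hF.dist_le_mul (x + h • v) (x - h • v)
  rw [Real.dist_eq, dist_eq_norm, show x + h • v - (x - h • v) = (2 * h) • v by module, norm_smul,
    Real.norm_of_nonneg (by positivity)] at h1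
  rw [abs_mul, abs_of_pos (by positivity)]
  calc _ ≤ 1 / (2 * h) * (L * (2 * h * ‖v‖)) := by gcongr
    _ = _ := by field_simp

/-- The extension of degree one of a bounded Lipschitz function on the sphere is Lipschitz. -/
theorem lipschitzWith_norm_mul {L : ℝ≥0} {g : EuclideanSpace ℝ (Fin n) → ℝ}
    (hg : LipschitzWith L g) (hgL : ∀ v, ‖v‖ = 1 → |g v| ≤ L) :
    LipschitzWith (3 * L) fun x => ‖x‖ * g (‖x‖⁻¹ • x) := by
  have hunit : ∀ x : EuclideanSpace ℝ (Fin n), x ≠ 0 → ‖‖x‖⁻¹ • x‖ = 1 := fun x hx => by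
    rw [norm_smul, norm_inv, norm_norm, inv_mul_cancel₀ (norm_ne_zero_iff.2 hx)]
  have hb : ∀ x : EuclideanSpace ℝ (Fin n), ‖x‖ * |g (‖x‖⁻¹ • x)| ≤ L * ‖x‖ := fun x => by
    rcases eq_or_ne x 0 with rfl | hx
    · simp
    · rw [mul_comm]
      exact mul_le_mul_of_nonneg_right (hgL _ (hunit x hx)) (norm_nonneg _)
  refine LipschitzWith.of_dist_le_mul fun x y => ?_
  rw [Real.dist_eq, dist_eq_norm]
  push_cast
  rcases eq_or_ne x 0 with rfl | hx
  · have := hb y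
    simp only [norm_zero, zero_mul, zero_sub, abs_neg, abs_mul, abs_norm, norm_neg]
    nlinarith [mul_nonneg L.coe_nonneg (norm_nonneg y)]
  rcases eq_or_ne y 0 with rfl | hy
  · have := hb x
    simp only [norm_zero, zero_mul, sub_zero, abs_mul, abs_norm]
    nlinarith [mul_nonneg L.coe_nonneg (norm_nonneg x)]
  have h1 : ‖y‖ * ‖‖x‖⁻¹ • x - ‖y‖⁻¹ • y‖ ≤ 2 * ‖x - y‖ := by
    have e : ‖y‖ * ‖‖x‖⁻¹ • x - ‖y‖⁻¹ • y‖ = ‖(‖y‖ - ‖x‖) • (‖x‖⁻¹ • x) + (x - y)‖ := by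
      rw [← norm_norm y, ← norm_smul, norm_norm, smul_sub, smul_inv_smul₀ (norm_ne_zero_iff.2 hy),
        sub_smul, smul_inv_smul₀ (norm_ne_zero_iff.2 hx)]
      congr 1
      abel
    rw [e]
    refine (norm_add_le _ _).trans ?_
    rw [norm_smul, hunit x hx, mul_one, Real.norm_eq_abs, abs_sub_comm]
    linarith [abs_norm_sub_norm_le x y]
  have h2 := hg.dist_le_mul (‖x‖⁻¹ • x) (‖y‖⁻¹ • y)
  rw [Real.dist_eq, dist_eq_norm] at h2
  calc |‖x‖ * g (‖x‖⁻¹ • x) - ‖y‖ * g (‖y‖⁻¹ • y)|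
      = |(‖x‖ - ‖y‖) * g (‖x‖⁻¹ • x) + ‖y‖ * (g (‖x‖⁻¹ • x) - g (‖y‖⁻¹ • y))| := by
        congr 1; ring
    _ ≤ |‖x‖ - ‖y‖| * |g (‖x‖⁻¹ • x)| + ‖y‖ * |g (‖x‖⁻¹ • x) - g (‖y‖⁻¹ • y)| := by
        refine (abs_add_le _ _).trans ?_
        rw [abs_mul, abs_mul, abs_norm]
    _ ≤ ‖x - y‖ * L + ‖y‖ * (L * ‖‖x‖⁻¹ • x - ‖y‖⁻¹ • y‖) := by
        gcongr
        · exact abs_norm_sub_norm_le x y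
        · exact hgL _ (hunit x hx)
    _ = ‖x - y‖ * L + L * (‖y‖ * ‖‖x‖⁻¹ • x - ‖y‖⁻¹ • y‖) := by ring
    _ ≤ ‖x - y‖ * L + L * (2 * ‖x - y‖) := by gcongr
    _ = 3 * L * ‖x - y‖ := by ring

/-- The second moment of a central difference along a uniform direction is `O(L² / n)`: the
difference quotient is odd in the direction, so the Gaussian Poincaré inequality bounds its
homogeneous extension of degree one. -/
theorem isDifferenceConstant_pi : IsDifferenceConstant (9 * Real.pi ^ 2 / 4) := by
  intro n hn L F hF x h hh
  set g : EuclideanSpace ℝ (Fin n) → ℝ :=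
    fun v => 1 / (2 * h) * (F (x + h • v) - F (x - h • v)) with hg
  have hgL : LipschitzWith L g := by
    refine LipschitzWith.of_dist_le_mul fun v w => ?_
    have h1 := hF.dist_le_mul (x + h • v) (x + h • w)
    have h2 := hF.dist_le_mul (x - h • v) (x - h • w)
    rw [Real.dist_eq, dist_eq_norm, show x + h • v - (x + h • w) = h • (v - w) by module,
      norm_smul, Real.norm_of_nonneg hh.le] at h1
    rw [Real.dist_eq, dist_eq_norm, show x - h • v - (x - h • w) = -(h • (v - w)) by module,
      norm_neg, norm_smul, Real.norm_of_nonneg hh.le] at h2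
    rw [Real.dist_eq, dist_eq_norm, show g v - g w = 1 / (2 * h) * ((F (x + h • v) -
      F (x + h • w)) - (F (x - h • v) - F (x - h • w))) by simp only [hg]; ring, abs_mul,
      abs_of_pos (by positivity)]
    calc _ ≤ 1 / (2 * h) * (L * (h * ‖v - w‖) + L * (h * ‖v - w‖)) := by
          gcongr
          exact (abs_sub _ _).trans (add_le_add h1 h2)
      _ = _ := by field_simp; ring
  have hgb : ∀ v, ‖v‖ = 1 → |g v| ≤ L := fun v hv => by
    have := abs_difference_quotient_le hF hh x v
    rwa [hv, mul_one] at this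
  have hodd : ∀ v, g (-v) = -g v := fun v => by
    simp only [hg, smul_neg, sub_neg_eq_add, ← sub_eq_add_neg]
    ring
  have h1 : ∫ v, ‖centralDifference F h x v‖ ^ 2 ∂(sphereUniform n) =
      ∫ v, g v ^ 2 ∂(sphereUniform n) := by
    refine integral_congr_ae ?_
    filter_upwards [ae_norm_eq_one] with v hv
    rw [centralDifference, norm_smul, hv, mul_one, Real.norm_eq_abs, sq_abs]
  have h2 := integral_sq_norm_mul_stdGaussian hn fun v => g v ^ 2
  have h3 := integral_sq_odd_le (lipschitzWith_norm_mul hgL hgb) fun v => by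
    simp only [norm_neg, smul_neg, hodd]
    ring
  simp only [mul_pow] at h3
  rw [h2] at h3
  have hn' : (0 : ℝ) < n := by exact_mod_cast hn
  rw [h1, le_div_iff₀ hn']
  push_cast at h3
  nlinarith [h3]

/-- In dimension one the identity attains the second moment `L² / n`. -/
theorem one_le_of_isDifferenceConstant {C : ℝ} (hC : IsDifferenceConstant C) : 1 ≤ C := by
  have hF : LipschitzWith 1 fun x : EuclideanSpace ℝ (Fin 1) => x 0 := by
    refine LipschitzWith.of_dist_le_mul fun x y => ?_
    simp [EuclideanSpace.dist_eq, Real.sqrt_sq_eq_abs, Real.dist_eq]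
  have h1 := hC 1 le_rfl 1 _ hF 0 1 one_pos
  have := isProbabilityMeasure_sphereUniform (n := 1) le_rfl
  have h2 : ∫ v, ‖centralDifference (fun x : EuclideanSpace ℝ (Fin 1) => x 0) 1 0 v‖ ^ 2
      ∂(sphereUniform 1) = ∫ _, 1 ∂(sphereUniform 1) := by
    refine integral_congr_ae ?_
    filter_upwards [ae_norm_eq_one] with v hv
    have hv' : |v 0| = 1 := by
      rw [EuclideanSpace.norm_eq] at hv
      simpa [Real.sqrt_sq_eq_abs] using hv
    rw [centralDifference, norm_smul, hv, Real.norm_eq_abs, mul_one, sq_abs]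
    have h3 : 1 / (2 * 1) * ((0 + (1 : ℝ) • v) 0 - (0 - (1 : ℝ) • v) 0) = v 0 := by
      simp
      ring
    rw [h3, ← sq_abs, hv', one_pow]
  rw [h2] at h1
  simpa using h1

end DifferenceConstant

/-! ### Ball smoothing and its subgradients -/

section Smoothing

variable {n : ℕ}

theorem ballSmoothing_eq (F : EuclideanSpace ℝ (Fin n) → ℝ) (h : ℝ)
    (x : EuclideanSpace ℝ (Fin n)) :
    ballSmoothing F h x =
      ((volume : Measure (EuclideanSpace ℝ (Fin n))).real (Metric.closedBall 0 1))⁻¹ *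
        ∫ y in Metric.closedBall (0 : EuclideanSpace ℝ (Fin n)) 1, F (x + h • y) := by
  rw [ballSmoothing, setAverage_eq, smul_eq_mul]

theorem volume_real_closedBall_one_pos :
    0 < (volume : Measure (EuclideanSpace ℝ (Fin n))).real (Metric.closedBall 0 1) :=
  ENNReal.toReal_pos (Metric.measure_closedBall_pos _ _ one_pos).ne' measure_closedBall_lt_top.ne

theorem volume_real_closedBall_one (hn : 1 ≤ n) :
    (volume : Measure (EuclideanSpace ℝ (Fin n))).real (Metric.closedBall 0 1) =
      (volume : Measure (EuclideanSpace ℝ (Fin n))).real (Metric.ball 0 1) := by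
  have := nontrivial_euclideanSpace hn
  rw [measureReal_def, Measure.addHaar_closedBall_eq_addHaar_ball, ← measureReal_def]

theorem integrableOn_unitBall {F : EuclideanSpace ℝ (Fin n) → ℝ} (hF : Continuous F) (h : ℝ)
    (x : EuclideanSpace ℝ (Fin n)) :
    IntegrableOn (fun y => F (x + h • y)) (Metric.closedBall 0 1) :=
  (by fun_prop : Continuous fun y => F (x + h • y)).continuousOn.integrableOn_compact
    (isCompact_closedBall _ _)

theorem ballSmoothing_congr {F G : EuclideanSpace ℝ (Fin n) → ℝ} {h : ℝ} (hh : 0 ≤ h)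
    {x : EuclideanSpace ℝ (Fin n)} (hFG : Set.EqOn F G (Metric.closedBall x h)) :
    ballSmoothing F h x = ballSmoothing G h x := by
  rw [ballSmoothing_eq, ballSmoothing_eq]
  congr 1
  refine setIntegral_congr_fun measurableSet_closedBall fun y hy => hFG ?_
  have hy' : ‖y‖ ≤ 1 := by simpa using hy
  simpa [norm_smul, abs_of_nonneg hh] using mul_le_of_le_one_right hh hy'

theorem ballSmoothing_sub_le {F : EuclideanSpace ℝ (Fin n) → ℝ} (hF : Continuous F) (h : ℝ)
    (x z : EuclideanSpace ℝ (Fin n)) {c : ℝ}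
    (hc : ∀ y, ‖y‖ ≤ 1 → F (x + h • y) - F (z + h • y) ≤ c) :
    ballSmoothing F h x - ballSmoothing F h z ≤ c := by
  have hV := volume_real_closedBall_one_pos (n := n)
  rw [ballSmoothing_eq, ballSmoothing_eq, ← mul_sub,
    ← integral_sub (integrableOn_unitBall hF h x) (integrableOn_unitBall hF h z),
    inv_mul_le_iff₀ hV, ← smul_eq_mul, ← setIntegral_const]
  refine setIntegral_mono_on ((integrableOn_unitBall hF h x).sub (integrableOn_unitBall hF h z))
    (integrableOn_const measure_closedBall_lt_top.ne) measurableSet_closedBall fun y hy => ?_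
  exact hc y (by simpa using hy)

theorem lipschitzWith_ballSmoothing {L : ℝ≥0} {F : EuclideanSpace ℝ (Fin n) → ℝ}
    (hF : LipschitzWith L F) (h : ℝ) : LipschitzWith L (ballSmoothing F h) := by
  refine LipschitzWith.of_le_add_mul L fun x z => ?_
  have := ballSmoothing_sub_le hF.continuous h x z (c := L * dist x z) fun y _ => by
    have := hF.dist_le_mul (x + h • y) (z + h • y)
    rw [dist_add_right] at this
    exact (le_abs_self _).trans this
  linarith

theorem ballSmoothing_le_add {L : ℝ≥0} {F : EuclideanSpace ℝ (Fin n) → ℝ}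
    (hF : LipschitzWith L F) {h : ℝ} (hh : 0 ≤ h) (x : EuclideanSpace ℝ (Fin n)) :
    ballSmoothing F h x ≤ F x + L * h := by
  have hV := volume_real_closedBall_one_pos (n := n)
  rw [ballSmoothing_eq, inv_mul_le_iff₀ hV, ← smul_eq_mul, ← setIntegral_const]
  refine setIntegral_mono_on (integrableOn_unitBall hF.continuous h x)
    (integrableOn_const measure_closedBall_lt_top.ne) measurableSet_closedBall fun y hy => ?_
  have h1 := hF.dist_le_mul (x + h • y) x
  rw [Real.dist_eq, dist_self_add_left, norm_smul, Real.norm_of_nonneg hh] at h1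
  have hy' : ‖y‖ ≤ 1 := by simpa using hy
  have h2 : (L : ℝ) * (h * ‖y‖) ≤ L * h :=
    mul_le_mul_of_nonneg_left (mul_le_of_le_one_right hh hy') L.2
  linarith [le_abs_self (F (x + h • y) - F x)]

theorem add_smul_mem_closedBall {h : ℝ} (hh : 0 ≤ h) (x : EuclideanSpace ℝ (Fin n))
    {y : EuclideanSpace ℝ (Fin n)} (hy : ‖y‖ ≤ 1) : x + h • y ∈ Metric.closedBall x h := by
  simpa [norm_smul, abs_of_nonneg hh] using mul_le_of_le_one_right hh hy

/-- By convexity, the two values at antipodal points of the ball average to at least the value at the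
centre. -/
theorem le_ballSmoothing {F : EuclideanSpace ℝ (Fin n) → ℝ} (hF : Continuous F)
    {U : Set (EuclideanSpace ℝ (Fin n))} (hconv : ConvexOn ℝ U F) {h : ℝ} (hh : 0 ≤ h)
    {x : EuclideanSpace ℝ (Fin n)} (hx : Metric.closedBall x h ⊆ U) :
    F x ≤ ballSmoothing F h x := by
  have hV := volume_real_closedBall_one_pos (n := n)
  have hneg : ∫ y in Metric.closedBall (0 : EuclideanSpace ℝ (Fin n)) 1, F (x + h • -y) =
      ∫ y in Metric.closedBall (0 : EuclideanSpace ℝ (Fin n)) 1, F (x + h • y) := by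
    have := (Measure.measurePreserving_neg
      (volume : Measure (EuclideanSpace ℝ (Fin n)))).setIntegral_preimage_emb
      (MeasurableEquiv.neg _).measurableEmbedding (fun y => F (x + h • y)) (Metric.closedBall 0 1)
    simpa using this
  have hi1 := integrableOn_unitBall hF h x
  have hi2 : IntegrableOn (fun y => F (x + h • -y)) (Metric.closedBall 0 1) :=
    (by fun_prop : Continuous fun y => F (x + h • -y)).continuousOn.integrableOn_compact
      (isCompact_closedBall _ _)
  have h2 : (volume : Measure (EuclideanSpace ℝ (Fin n))).real (Metric.closedBall 0 1) *
      (2 * F x) ≤ ∫ y in Metric.closedBall (0 : EuclideanSpace ℝ (Fin n)) 1,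
        (F (x + h • y) + F (x + h • -y)) := by
    rw [← smul_eq_mul, ← setIntegral_const]
    refine setIntegral_mono_on (integrableOn_const measure_closedBall_lt_top.ne) (hi1.add hi2)
      measurableSet_closedBall fun y hy => ?_
    have hy' : ‖y‖ ≤ 1 := by simpa using hy
    have h3 := hconv.2 (hx (add_smul_mem_closedBall hh x hy'))
      (hx (add_smul_mem_closedBall hh x (y := -y) (by simpa using hy')))
      (by norm_num : (0 : ℝ) ≤ 1 / 2) (by norm_num : (0 : ℝ) ≤ 1 / 2) (by norm_num)
    rw [show (1 / 2 : ℝ) • (x + h • y) + (1 / 2 : ℝ) • (x + h • -y) = x by module] at h3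
    simp only [smul_eq_mul] at h3
    linarith
  rw [integral_add hi1 hi2, hneg] at h2
  rw [ballSmoothing_eq, le_inv_mul_iff₀ hV]
  linarith

theorem convexOn_ballSmoothing {F : EuclideanSpace ℝ (Fin n) → ℝ} (hF : Continuous F)
    {U X : Set (EuclideanSpace ℝ (Fin n))} (hconv : ConvexOn ℝ U F) (hX : Convex ℝ X) {h : ℝ}
    (hh : 0 ≤ h) (hXU : ∀ x ∈ X, Metric.closedBall x h ⊆ U) :
    ConvexOn ℝ X (ballSmoothing F h) := by
  refine ⟨hX, fun x hx z hz a b ha hb hab => ?_⟩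
  have hV := volume_real_closedBall_one_pos (n := n)
  have hi := integrableOn_unitBall hF h
  simp only [ballSmoothing_eq, smul_eq_mul]
  rw [show ∀ V I J : ℝ, a * (V * I) + b * (V * J) = V * (a * I + b * J) from fun _ _ _ => by ring]
  refine mul_le_mul_of_nonneg_left ?_ (inv_nonneg.2 hV.le)
  rw [← integral_const_mul, ← integral_const_mul, ← integral_add ((hi x).const_mul a)
    ((hi z).const_mul b)]
  refine setIntegral_mono_on (hi _) (((hi x).const_mul a).add ((hi z).const_mul b))
    measurableSet_closedBall fun y hy => ?_
  have hy' : ‖y‖ ≤ 1 := by simpa using hy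
  have h3 := hconv.2 (hXU x hx (add_smul_mem_closedBall hh x hy'))
    (hXU z hz (add_smul_mem_closedBall hh z hy')) ha hb hab
  have e : a • (x + h • y) + b • (z + h • y) = a • x + b • z + h • y := by
    obtain rfl : b = 1 - a := by linarith
    module
  rwa [e] at h3

theorem lipschitzWith_comp_add_smul {L : ℝ≥0} {F : EuclideanSpace ℝ (Fin n) → ℝ}
    (hF : LipschitzWith L F) {h : ℝ} (hh : 0 ≤ h) (x : EuclideanSpace ℝ (Fin n)) :
    LipschitzWith (L * h.toNNReal) fun y => F (x + h • y) := by
  refine LipschitzWith.of_dist_le_mul fun y z => ?_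
  have := hF.dist_le_mul (x + h • y) (x + h • z)
  rw [dist_add_left, dist_smul₀, Real.norm_of_nonneg hh] at this
  rw [NNReal.coe_mul, Real.coe_toNNReal _ hh, mul_assoc]
  exact this

/-- The mean of the central difference, paired with `w`, is the mean over the unit ball of the
derivative of `y ↦ F (x + h y)` along `w`, up to the factor `1 / (n h)`. -/
theorem inner_integral_centralDifference (hn : 1 ≤ n) {L : ℝ≥0}
    {F : EuclideanSpace ℝ (Fin n) → ℝ} (hF : LipschitzWith L F) {h : ℝ} (hh : 0 < h)
    (x w : EuclideanSpace ℝ (Fin n)) :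
    n * h * (volume : Measure (EuclideanSpace ℝ (Fin n))).real (Metric.closedBall 0 1) *
      inner ℝ (∫ v, centralDifference F h x v ∂(sphereUniform n)) w =
    ∫ y in Metric.closedBall 0 1, lineDeriv ℝ (fun y => F (x + h • y)) y w := by
  have hFc := hF.continuous
  set ψ : EuclideanSpace ℝ (Fin n) → ℝ := fun v => inner ℝ v w * F (x + h • v) with hψ
  have hψc : Continuous ψ := by fun_prop
  have hcd : Continuous fun v => centralDifference F h x v := by
    unfold centralDifference
    fun_prop
  rw [setIntegral_lineDeriv_closedBall hn (lipschitzWith_comp_add_smul hF hh.le x),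
    ← volume_real_closedBall_one hn, real_inner_comm,
    ← integral_inner (integrable_sphereUniform_of_continuous hn hcd)]
  have h1 : ∀ v, inner ℝ w (centralDifference F h x v) = 1 / (2 * h) * (ψ v + ψ (-v)) := by
    intro v
    simp only [hψ, centralDifference, inner_smul_right, inner_neg_left, smul_neg,
      ← sub_eq_add_neg, real_inner_comm w v]
    ring
  simp_rw [h1]
  rw [integral_const_mul, integral_add (integrable_sphereUniform_of_continuous hn hψc)
    (integrable_sphereUniform_of_continuous hn (f := fun v => ψ (-v))
      (hψc.comp continuous_neg)),
    integral_sphereUniform_neg hn ψ]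
  field_simp
  ring

/-- The mean of the central difference is smaller by the factor `n` than its pointwise bound `L`; this
controls the off-diagonal terms in the second moment of a batch. -/
theorem norm_integral_centralDifference_le (hn : 1 ≤ n) {L : ℝ≥0}
    {F : EuclideanSpace ℝ (Fin n) → ℝ} (hF : LipschitzWith L F) {h : ℝ} (hh : 0 < h)
    (x : EuclideanSpace ℝ (Fin n)) :
    ‖∫ v, centralDifference F h x v ∂(sphereUniform n)‖ ≤ L / n := by
  set m := ∫ v, centralDifference F h x v ∂(sphereUniform n) with hm
  have hV := volume_real_closedBall_one_pos (n := n)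
  set V := (volume : Measure (EuclideanSpace ℝ (Fin n))).real (Metric.closedBall 0 1)
  have hn' : (0 : ℝ) < n := by exact_mod_cast hn
  have h1 := inner_integral_centralDifference hn hF hh x m
  rw [← hm, real_inner_self_eq_norm_sq] at h1
  have h2 : ‖∫ y in Metric.closedBall 0 1, lineDeriv ℝ (fun y => F (x + h • y)) y m‖ ≤
      L * h * ‖m‖ * V :=
    norm_setIntegral_le_of_norm_le_const measure_closedBall_lt_top fun y _ => by
      have := norm_lineDeriv_le_of_lipschitz ℝ (x₀ := y) (v := m)
        (lipschitzWith_comp_add_smul hF hh.le x)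
      rwa [NNReal.coe_mul, Real.coe_toNNReal _ hh.le] at this
  rw [← h1, Real.norm_of_nonneg (by positivity)] at h2
  rcases (norm_nonneg m).eq_or_lt with h0 | h0
  · rw [← h0]
    positivity
  · rw [le_div_iff₀ hn']
    have h3 : (h * V * ‖m‖) * (‖m‖ * n) ≤ (h * V * ‖m‖) * L := by linarith
    exact le_of_mul_le_mul_left h3 (by positivity)

/-- `n` times the mean of the central difference is a subgradient of the smoothed function. -/
theorem ballSmoothing_sub_le_inner (hn : 1 ≤ n) {L : ℝ≥0}
    {F : EuclideanSpace ℝ (Fin n) → ℝ} (hF : LipschitzWith L F)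
    {U : Set (EuclideanSpace ℝ (Fin n))} (hconv : ConvexOn ℝ U F) {h : ℝ} (hh : 0 < h)
    {x z : EuclideanSpace ℝ (Fin n)} (hx : Metric.closedBall x h ⊆ U)
    (hz : Metric.closedBall z h ⊆ U) :
    ballSmoothing F h x - ballSmoothing F h z ≤
      n * inner ℝ (∫ v, centralDifference F h x v ∂(sphereUniform n)) (x - z) := by
  have hV := volume_real_closedBall_one_pos (n := n)
  have hFc := hF.continuous
  have hlip := lipschitzWith_comp_add_smul hF hh.le x
  have hi := integrableOn_unitBall hFc h
  have h1 := inner_integral_centralDifference hn hF hh x (z - x)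
  have h2 : ∫ y in Metric.closedBall 0 1, lineDeriv ℝ (fun y => F (x + h • y)) y (z - x) ≤
      ∫ y in Metric.closedBall 0 1, h * (F (z + h • y) - F (x + h • y)) := by
    refine setIntegral_mono_ae_restrict ?_ (((hi z).sub (hi x)).const_mul h) ?_
    · exact Measure.integrableOn_of_bounded measure_closedBall_lt_top.ne
        (measurable_lineDeriv hlip.continuous).aestronglyMeasurable
        (Eventually.of_forall fun y => norm_lineDeriv_le_of_lipschitz ℝ hlip)
    · rw [EventuallyLE, ae_restrict_iff' measurableSet_closedBall]
      filter_upwards [hlip.ae_lineDifferentiableAt (z - x)] with y hy hyB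
      have hy' : ‖y‖ ≤ 1 := by simpa using hyB
      have hd : HasDerivAt (fun t : ℝ => F (x + h • (y + t • (z - x))))
          (lineDeriv ℝ (fun y => F (x + h • y)) y (z - x)) 0 := hy.hasLineDerivAt
      refine le_of_tendsto hd.tendsto_slope_zero_right ?_
      filter_upwards [Ioo_mem_nhdsGT (show (0 : ℝ) < 1 / h by positivity)] with t ht
      have ht0 : 0 < t := ht.1
      have ht1 : h * t ≤ 1 := by
        have := ht.2.le
        rw [le_div_iff₀ hh] at this
        linarith
      have h3 := hconv.2 (hx (add_smul_mem_closedBall hh.le x hy'))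
        (hz (add_smul_mem_closedBall hh.le z hy')) (sub_nonneg.2 ht1)
        (by positivity : 0 ≤ h * t) (by ring)
      rw [show (1 - h * t) • (x + h • y) + (h * t) • (z + h • y) =
        x + h • (y + t • (z - x)) by module] at h3
      simp only [smul_eq_mul] at h3
      simp only [zero_add, zero_smul, add_zero, smul_eq_mul]
      rw [inv_mul_le_iff₀ ht0]
      linarith
  rw [integral_const_mul, integral_sub (hi z) (hi x), ← h1] at h2
  rw [ballSmoothing_eq, ballSmoothing_eq, ← neg_sub z x, inner_neg_right, ← mul_sub,
    inv_mul_le_iff₀ hV]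
  refine le_of_mul_le_mul_left ?_ hh
  linarith

end Smoothing

/-! ### Moments of the batch direction -/

section Batch

variable {n K : ℕ}

theorem continuous_batchDirection {F : EuclideanSpace ℝ (Fin n) → ℝ} (hF : Continuous F) (h : ℝ) :
    Continuous fun p : EuclideanSpace ℝ (Fin n) × (Fin K → EuclideanSpace ℝ (Fin n)) =>
      batchDirection F h p.1 p.2 := by
  unfold batchDirection centralDifference
  fun_prop

theorem ae_pi_norm_eq_one (hn : 1 ≤ n) :
    ∀ᵐ v ∂(Measure.pi fun _ : Fin K => sphereUniform n), ∀ k, ‖v k‖ = 1 := by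
  have := isProbabilityMeasure_sphereUniform hn
  rw [ae_all_iff]
  exact fun k => (measurePreserving_eval (fun _ : Fin K => sphereUniform n)
    k).quasiMeasurePreserving.ae ae_norm_eq_one

theorem isCompact_sphere_pi :
    IsCompact (Set.univ.pi fun _ : Fin K => Metric.sphere (0 : EuclideanSpace ℝ (Fin n)) 1) :=
  isCompact_univ_pi fun _ => isCompact_sphere _ _

/-- A continuous function of a random point that almost surely lies in a compact set is
integrable. -/
theorem integrable_comp_of_ae_mem_isCompact {Ω A H : Type*} [MeasurableSpace Ω]
    {P : Measure Ω} [IsFiniteMeasure P] [TopologicalSpace A] [MeasurableSpace A]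
    [OpensMeasurableSpace A] [SecondCountableTopology A] [TopologicalSpace.PseudoMetrizableSpace A]
    [NormedAddCommGroup H] {f : A → H} (hf : Continuous f) {S : Set A} (hS : IsCompact S)
    {ξ : Ω → A} (hξ : AEMeasurable ξ P) (hξS : ∀ᵐ ω ∂P, ξ ω ∈ S) :
    Integrable (fun ω => f (ξ ω)) P := by
  obtain ⟨M, hM⟩ := hS.exists_bound_of_continuousOn hf.continuousOn
  refine Integrable.of_bound (hf.comp_aestronglyMeasurable hξ.aestronglyMeasurable) M ?_
  filter_upwards [hξS] with ω hω
  exact hM _ hω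

theorem integrable_pi_of_continuous (hn : 1 ≤ n) {H : Type*} [NormedAddCommGroup H]
    {f : (Fin K → EuclideanSpace ℝ (Fin n)) → H} (hf : Continuous f) :
    Integrable f (Measure.pi fun _ : Fin K => sphereUniform n) := by
  have := isProbabilityMeasure_sphereUniform hn
  refine integrable_comp_of_ae_mem_isCompact hf isCompact_sphere_pi aemeasurable_id ?_
  filter_upwards [ae_pi_norm_eq_one hn] with v hv
  simpa using hv

theorem integral_pi_comp_eval (hn : 1 ≤ n) {H : Type*} [NormedAddCommGroup H] [NormedSpace ℝ H]
    {f : EuclideanSpace ℝ (Fin n) → H} (hf : Continuous f) (k : Fin K) :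
    ∫ v, f (v k) ∂(Measure.pi fun _ : Fin K => sphereUniform n) =
      ∫ v, f v ∂(sphereUniform n) := by
  have := isProbabilityMeasure_sphereUniform hn
  have hmp := measurePreserving_eval (fun _ : Fin K => sphereUniform n) k
  have h1 := integral_map (μ := Measure.pi fun _ : Fin K => sphereUniform n)
    hmp.measurable.aemeasurable (f := f) hf.aestronglyMeasurable
  rw [hmp.map_eq] at h1
  exact h1.symm

theorem integral_pi_centralDifference (hn : 1 ≤ n) {F : EuclideanSpace ℝ (Fin n) → ℝ}
    (hF : Continuous F) (h : ℝ) (x : EuclideanSpace ℝ (Fin n)) (k : Fin K) :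
    ∫ v, centralDifference F h x (v k) ∂(Measure.pi fun _ : Fin K => sphereUniform n) =
      ∫ v, centralDifference F h x v ∂(sphereUniform n) := by
  refine integral_pi_comp_eval hn ?_ k
  unfold centralDifference
  fun_prop

theorem integral_pi_batchDirection (hn : 1 ≤ n) (hK : 1 ≤ K)
    {F : EuclideanSpace ℝ (Fin n) → ℝ} (hF : Continuous F) (h : ℝ)
    (x : EuclideanSpace ℝ (Fin n)) :
    ∫ v, batchDirection F h x v ∂(Measure.pi fun _ : Fin K => sphereUniform n) =
      ∫ v, centralDifference F h x v ∂(sphereUniform n) := by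
  have hK' : (K : ℝ) ≠ 0 := by positivity
  have hc : ∀ k : Fin K, Continuous fun v : Fin K → EuclideanSpace ℝ (Fin n) =>
      centralDifference F h x (v k) := fun k => by
    unfold centralDifference
    fun_prop
  unfold batchDirection
  rw [integral_smul, integral_finsetSum _ fun k _ => integrable_pi_of_continuous hn (hc k)]
  simp_rw [integral_pi_centralDifference hn hF]
  rw [Finset.sum_const, Finset.card_univ, Fintype.card_fin, ← Nat.cast_smul_eq_nsmul ℝ, smul_smul,
    one_div, inv_mul_cancel₀ hK', one_smul]

/-- Second moment of the batch direction: the diagonal terms are controlled by the second moment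
of one central difference, the off-diagonal ones by the squared norm of its mean. -/
theorem integral_pi_sq_norm_batchDirection_le (hn : 1 ≤ n) (hK : 1 ≤ K) {C : ℝ}
    (hC : IsDifferenceConstant C) {L : ℝ≥0} {F : EuclideanSpace ℝ (Fin n) → ℝ}
    (hF : LipschitzWith L F) {h : ℝ} (hh : 0 < h) (x : EuclideanSpace ℝ (Fin n)) :
    ∫ v, ‖batchDirection F h x v‖ ^ 2 ∂(Measure.pi fun _ : Fin K => sphereUniform n) ≤
      (L : ℝ) ^ 2 / (n * K) * (C + K / n) := by
  have := isProbabilityMeasure_sphereUniform hn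
  have hFc := hF.continuous
  have hn' : (0 : ℝ) < n := by exact_mod_cast hn
  have hK' : (0 : ℝ) < K := by exact_mod_cast hK
  set π := Measure.pi fun _ : Fin K => sphereUniform n with hπ
  set m := ∫ v, centralDifference F h x v ∂(sphereUniform n) with hm
  have hc1 : Continuous fun v => centralDifference F h x v := by
    unfold centralDifference
    fun_prop
  have hc : ∀ k : Fin K, Continuous fun v : Fin K → EuclideanSpace ℝ (Fin n) =>
      centralDifference F h x (v k) := fun k => hc1.comp (continuous_apply k)
  have hi : ∀ k j : Fin K, Integrable (fun v : Fin K → EuclideanSpace ℝ (Fin n) =>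
      (inner ℝ (centralDifference F h x (v k)) (centralDifference F h x (v j)) : ℝ)) π :=
    fun k j => integrable_pi_of_continuous hn ((hc k).inner (hc j))
  have hdiag : ∀ k : Fin K, ∫ v, inner ℝ (centralDifference F h x (v k))
      (centralDifference F h x (v k)) ∂π ≤ C * (L : ℝ) ^ 2 / n := by
    intro k
    refine le_of_eq_of_le ?_ (hC n hn L F hF x h hh)
    simp_rw [real_inner_self_eq_norm_sq]
    exact integral_pi_comp_eval hn (hc1.norm.pow 2) k
  have hoff : ∀ k j : Fin K, k ≠ j → ∫ v, inner ℝ (centralDifference F h x (v k))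
      (centralDifference F h x (v j)) ∂π ≤ ((L : ℝ) / n) ^ 2 := by
    intro k j hkj
    have hind : iIndepFun (fun (i : Fin K) (v : Fin K → EuclideanSpace ℝ (Fin n)) =>
        centralDifference F h x (v i)) π :=
      iIndepFun_pi (X := fun _ => centralDifference F h x) fun i => hc1.measurable.aemeasurable
    have h1 : ∫ v, inner ℝ (centralDifference F h x (v k)) (centralDifference F h x (v j)) ∂π =
        inner ℝ (∫ v, centralDifference F h x (v k) ∂π) (∫ v, centralDifference F h x (v j) ∂π) :=
      (hind.indepFun hkj).integral_bilin (integrable_pi_of_continuous hn (hc k))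
        (integrable_pi_of_continuous hn (hc j)) (innerSL ℝ)
    rw [h1, integral_pi_centralDifference hn hFc, integral_pi_centralDifference hn hFc,
      real_inner_self_eq_norm_sq]
    gcongr
    exact norm_integral_centralDifference_le hn hF hh x
  have hexp : ∀ v : Fin K → EuclideanSpace ℝ (Fin n), ‖batchDirection F h x v‖ ^ 2 =
      (1 / (K : ℝ)) ^ 2 * ∑ k, ∑ j, inner ℝ (centralDifference F h x (v k))
        (centralDifference F h x (v j)) := by
    intro v
    rw [batchDirection, norm_smul, mul_pow, Real.norm_eq_abs, sq_abs, ← real_inner_self_eq_norm_sq,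
      sum_inner]
    simp_rw [inner_sum]
  simp_rw [hexp]
  rw [integral_const_mul, integral_finsetSum _ fun k _ => integrable_finsetSum _ fun j _ => hi k j]
  simp_rw [integral_finsetSum Finset.univ fun j _ => hi _ j]
  have hrow : ∀ k : Fin K, ∑ j, ∫ v, inner ℝ (centralDifference F h x (v k))
      (centralDifference F h x (v j)) ∂π ≤ C * (L : ℝ) ^ 2 / n + K * ((L : ℝ) / n) ^ 2 := by
    intro k
    rw [← Finset.add_sum_erase _ _ (Finset.mem_univ k)]
    refine add_le_add (hdiag k) ?_
    calc _ ≤ ∑ _j ∈ Finset.univ.erase k, ((L : ℝ) / n) ^ 2 :=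
          Finset.sum_le_sum fun j hj => hoff k j (Finset.ne_of_mem_erase hj).symm
      _ ≤ ∑ _j : Fin K, ((L : ℝ) / n) ^ 2 :=
          Finset.sum_le_sum_of_subset_of_nonneg (Finset.erase_subset _ _) fun _ _ _ => sq_nonneg _
      _ = _ := by simp
  calc _ ≤ (1 / (K : ℝ)) ^ 2 * ∑ _k : Fin K, (C * (L : ℝ) ^ 2 / n + K * ((L : ℝ) / n) ^ 2) := by
        gcongr with k
        exact hrow k
    _ = _ := by
        rw [Finset.sum_const, Finset.card_univ, Fintype.card_fin, nsmul_eq_mul]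
        field_simp

/-- Expected squared distance to `z` after one unprojected step from the fixed point `u`. -/
theorem integral_pi_sq_norm_step_le (hn : 1 ≤ n) (hK : 1 ≤ K) {C : ℝ}
    (hC : IsDifferenceConstant C) {L : ℝ≥0} {F : EuclideanSpace ℝ (Fin n) → ℝ}
    (hF : LipschitzWith L F) {U : Set (EuclideanSpace ℝ (Fin n))} (hconv : ConvexOn ℝ U F)
    {h : ℝ} (hh : 0 < h) {ρ : ℝ} (hρ : 0 ≤ ρ) {u z : EuclideanSpace ℝ (Fin n)}
    (hu : Metric.closedBall u h ⊆ U) (hz : Metric.closedBall z h ⊆ U) :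
    ∫ v, ‖u - ρ • batchDirection F h u v - z‖ ^ 2
      ∂(Measure.pi fun _ : Fin K => sphereUniform n) ≤
      ‖u - z‖ ^ 2 - 2 * ρ / n * (ballSmoothing F h u - ballSmoothing F h z) +
        ρ ^ 2 * ((L : ℝ) ^ 2 / (n * K) * (C + K / n)) := by
  have := isProbabilityMeasure_sphereUniform hn
  have hn' : (0 : ℝ) < n := by exact_mod_cast hn
  have hc : Continuous fun v : Fin K → EuclideanSpace ℝ (Fin n) => batchDirection F h u v := by
    have := hF.continuous
    unfold batchDirection centralDifference
    fun_prop
  have hexp : ∀ v : Fin K → EuclideanSpace ℝ (Fin n), ‖u - ρ • batchDirection F h u v - z‖ ^ 2 =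
      ‖u - z‖ ^ 2 - 2 * ρ * inner ℝ (u - z) (batchDirection F h u v) +
        ρ ^ 2 * ‖batchDirection F h u v‖ ^ 2 := by
    intro v
    rw [sub_right_comm, norm_sub_sq_real, inner_smul_right, norm_smul, mul_pow, Real.norm_eq_abs,
      sq_abs]
    ring
  have hi1 : Integrable (fun v : Fin K → EuclideanSpace ℝ (Fin n) =>
      2 * ρ * (inner ℝ (u - z) (batchDirection F h u v) : ℝ))
      (Measure.pi fun _ : Fin K => sphereUniform n) :=
    (integrable_pi_of_continuous hn (continuous_const.inner hc)).const_mul _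
  have hi2 : Integrable (fun v : Fin K → EuclideanSpace ℝ (Fin n) =>
      ρ ^ 2 * ‖batchDirection F h u v‖ ^ 2) (Measure.pi fun _ : Fin K => sphereUniform n) :=
    (integrable_pi_of_continuous hn (hc.norm.pow 2)).const_mul _
  have hi3 : Integrable (fun v : Fin K → EuclideanSpace ℝ (Fin n) =>
      ‖u - z‖ ^ 2 - 2 * ρ * (inner ℝ (u - z) (batchDirection F h u v) : ℝ))
      (Measure.pi fun _ : Fin K => sphereUniform n) := (integrable_const _).sub hi1
  have hm : ∫ v, (inner ℝ (u - z) (batchDirection F h u v) : ℝ)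
      ∂(Measure.pi fun _ : Fin K => sphereUniform n) =
      inner ℝ (∫ v, centralDifference F h u v ∂(sphereUniform n)) (u - z) := by
    rw [integral_inner (integrable_pi_of_continuous hn hc),
      integral_pi_batchDirection hn hK hF.continuous, real_inner_comm]
  rw [integral_congr_ae (Eventually.of_forall hexp), integral_add hi3 hi2,
    integral_sub (integrable_const _) hi1, integral_const_mul, integral_const_mul, hm]
  have h1 := ballSmoothing_sub_le_inner hn hF hconv hh hu hz
  have h2 := integral_pi_sq_norm_batchDirection_le hn hK hC hF hh u
  simp only [integral_const, probReal_univ, one_smul]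
  have h3 : 2 * ρ / n * (ballSmoothing F h u - ballSmoothing F h z) ≤
      2 * ρ * inner ℝ (∫ v, centralDifference F h u v ∂(sphereUniform n)) (u - z) := by
    rw [div_mul_eq_mul_div, div_le_iff₀ hn', mul_assoc, mul_assoc (2 * ρ), mul_assoc 2]
    have := mul_le_mul_of_nonneg_left h1 (by positivity : 0 ≤ 2 * ρ)
    linarith
  have h4 := mul_le_mul_of_nonneg_left h2 (sq_nonneg ρ)
  linarith

end Batch

/-! ### Euclidean projections -/

section Projection

variable {n : ℕ} {X : Set (EuclideanSpace ℝ (Fin n))}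

theorem IsProjection.inner_le_zero (hX : Convex ℝ X) {z p : EuclideanSpace ℝ (Fin n)}
    (hp : IsProjection X z p) {q : EuclideanSpace ℝ (Fin n)} (hq : q ∈ X) :
    inner ℝ (z - p) (q - p) ≤ 0 := by
  have : Nonempty X := ⟨⟨p, hp.1⟩⟩
  refine (norm_eq_iInf_iff_real_inner_le_zero hX hp.1).1 (le_antisymm ?_ ?_) q hq
  · exact le_ciInf fun w => hp.2 w w.2
  · exact ciInf_le ⟨0, by rintro _ ⟨w, rfl⟩; exact norm_nonneg _⟩ (⟨p, hp.1⟩ : X)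

theorem IsProjection.norm_sub_le (hX : Convex ℝ X) {z w p q : EuclideanSpace ℝ (Fin n)}
    (hp : IsProjection X z p) (hq : IsProjection X w q) : ‖p - q‖ ≤ ‖z - w‖ := by
  have h1 := hp.inner_le_zero hX hq.1
  have h2 := hq.inner_le_zero hX hp.1
  have h3 : ‖p - q‖ ^ 2 ≤ inner ℝ (z - w) (p - q) := by
    rw [← real_inner_self_eq_norm_sq]
    have e : (inner ℝ (z - w) (p - q) : ℝ) = inner ℝ (p - q) (p - q) - inner ℝ (z - p) (q - p) -
        inner ℝ (w - q) (p - q) := by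
      simp only [inner_sub_left, inner_sub_right]
      ring
    linarith
  have h4 := real_inner_le_norm (z - w) (p - q)
  rcases (norm_nonneg (p - q)).eq_or_lt with h0 | h0
  · rw [← h0]
    exact norm_nonneg _
  · exact le_of_mul_le_mul_right (by nlinarith) h0

theorem isProjection_self {z : EuclideanSpace ℝ (Fin n)} (hz : z ∈ X) : IsProjection X z z :=
  ⟨hz, fun q _ => by simp⟩

theorem IsProjection.eq (hX : Convex ℝ X) {z p q : EuclideanSpace ℝ (Fin n)}
    (hp : IsProjection X z p) (hq : IsProjection X z q) : p = q := by
  have := hp.norm_sub_le hX hq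
  rw [sub_self, norm_zero] at this
  exact sub_eq_zero.1 (norm_le_zero_iff.1 this)

theorem exists_continuous_isProjection (hX : Convex ℝ X) (hXc : IsCompact X) (hne : X.Nonempty) :
    ∃ p : EuclideanSpace ℝ (Fin n) → EuclideanSpace ℝ (Fin n),
      Continuous p ∧ ∀ z, IsProjection X z (p z) := by
  have h1 : ∀ z : EuclideanSpace ℝ (Fin n), ∃ p, IsProjection X z p := fun z => by
    obtain ⟨p, hp, hmin⟩ := hXc.exists_isMinOn hne
      (by fun_prop : Continuous fun q => ‖z - q‖).continuousOn
    exact ⟨p, hp, fun q hq => hmin hq⟩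
  choose p hp using h1
  refine ⟨p, (LipschitzWith.of_dist_le_mul (K := 1) fun z w => ?_).continuous, hp⟩
  rw [dist_eq_norm, dist_eq_norm, NNReal.coe_one, one_mul]
  exact (hp z).norm_sub_le hX (hp w)

end Projection

/-! ### Expected gaps along the trajectory -/

section Trajectory

variable {n K : ℕ} {Ω : Type*} [MeasurableSpace Ω] {P : Measure Ω}

/-- A process driven by independent noise through measurable updates is independent of the
current noise, for it depends on the earlier noise only. -/
theorem indepFun_of_recursion [IsProbabilityMeasure P] {A B : Type*} [MeasurableSpace A]
    [MeasurableSpace B] {Y : ℕ × Fin K → Ω → B} (hYm : ∀ i, Measurable (Y i))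
    (hYi : iIndepFun Y P) {f : ℕ → A × (Fin K → B) → A} (hf : ∀ s, Measurable (f s))
    {x : ℕ → Ω → A} {a : A} (h0 : ∀ ω, x 0 ω = a)
    (hs : ∀ s ω, x (s + 1) ω = f s (x s ω, fun k => Y (s, k) ω)) (s : ℕ) :
    Measurable (x s) ∧ IndepFun (x s) (fun ω k => Y (s, k) ω) P := by
  classical
  let S : ℕ → Finset (ℕ × Fin K) := fun s => Finset.range s ×ˢ Finset.univ
  have key : ∀ s, ∃ Φ : (S s → B) → A, Measurable Φ ∧ ∀ ω, x s ω = Φ fun i => Y i ω := by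
    intro s
    induction s with
    | zero => exact ⟨fun _ => a, measurable_const, h0⟩
    | succ s ih =>
      obtain ⟨Φ, hΦ, hx⟩ := ih
      have hsub : ∀ i : S s, (i : ℕ × Fin K) ∈ S (s + 1) := fun i => by
        have := i.2
        simp only [S, Finset.mem_product, Finset.mem_range, Finset.mem_univ, and_true] at this ⊢
        omega
      have hmem : ∀ k : Fin K, (s, k) ∈ S (s + 1) := fun k => by simp [S]
      refine ⟨fun v => f s (Φ fun i => v ⟨i, hsub i⟩, fun k => v ⟨(s, k), hmem k⟩), ?_, ?_⟩
      · refine (hf s).comp ((hΦ.comp ?_).prodMk ?_)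
        · exact measurable_pi_lambda _ fun i => measurable_pi_apply _
        · exact measurable_pi_lambda _ fun i => measurable_pi_apply _
      · intro ω
        rw [hs, hx]
  obtain ⟨Φ, hΦ, hx⟩ := key s
  have hxe : x s = Φ ∘ fun ω (i : S s) => Y i ω := funext hx
  refine ⟨?_, ?_⟩
  · rw [hxe]
    exact hΦ.comp (measurable_pi_lambda _ fun i => hYm i)
  · let T : Finset (ℕ × Fin K) := {s} ×ˢ Finset.univ
    have hmem : ∀ k : Fin K, (s, k) ∈ T := fun k => by simp [T]
    have hdisj : Disjoint (S s) T := by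
      rw [Finset.disjoint_left]
      intro i hi hi'
      simp only [S, T, Finset.mem_product, Finset.mem_range, Finset.mem_singleton] at hi hi'
      omega
    have h1 := hYi.indepFun_finset (S s) T hdisj hYm
    have h2 := h1.comp hΦ (ψ := fun (v : T → B) (k : Fin K) => v ⟨(s, k), hmem k⟩)
      (measurable_pi_lambda _ fun k => measurable_pi_apply _)
    rw [hxe]
    exact h2

/-- One step of the method decreases the expected squared distance to `z`, up to the second
moment of the step, by the expected gap of the smoothed function. -/
theorem integral_sq_norm_sub_step_le [IsProbabilityMeasure P] (hn : 1 ≤ n) (hK : 1 ≤ K) {C : ℝ}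
    (hC : IsDifferenceConstant C) {L : ℝ≥0} {G : EuclideanSpace ℝ (Fin n) → ℝ}
    (hG : LipschitzWith L G) {U X : Set (EuclideanSpace ℝ (Fin n))} (hconv : ConvexOn ℝ U G)
    (hX : Convex ℝ X) (hXc : IsCompact X) {h : ℝ} (hh : 0 < h)
    (hU : ∀ u ∈ X, Metric.closedBall u h ⊆ U) {ρ : ℝ} (hρ : 0 ≤ ρ)
    {ξ ξ' : Ω → EuclideanSpace ℝ (Fin n)} (hξ : Measurable ξ)
    (hξX : ∀ ω, ξ ω ∈ X)
    {Y : Ω → Fin K → EuclideanSpace ℝ (Fin n)} (hY : Measurable Y)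
    (hYl : P.map Y = Measure.pi fun _ => sphereUniform n) (hind : IndepFun ξ Y P)
    (hstep : ∀ ω, IsProjection X (ξ ω - ρ • batchDirection G h (ξ ω) (Y ω)) (ξ' ω))
    {z : EuclideanSpace ℝ (Fin n)} (hz : z ∈ X) :
    ∫ ω, ‖ξ' ω - z‖ ^ 2 ∂P ≤ ∫ ω, ‖ξ ω - z‖ ^ 2 ∂P -
      2 * ρ / n * ∫ ω, (ballSmoothing G h (ξ ω) - ballSmoothing G h z) ∂P +
        ρ ^ 2 * ((L : ℝ) ^ 2 / (n * K) * (C + K / n)) := by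
  have := isProbabilityMeasure_sphereUniform hn
  set M : ℝ := (L : ℝ) ^ 2 / (n * K) * (C + K / n) with hM
  set Ψ : EuclideanSpace ℝ (Fin n) × (Fin K → EuclideanSpace ℝ (Fin n)) → ℝ :=
    fun p => ‖p.1 - ρ • batchDirection G h p.1 p.2 - z‖ ^ 2 with hΨ
  have hbc := continuous_batchDirection (K := K) hG.continuous h
  have hΨc : Continuous Ψ := by fun_prop
  have hGh := (lipschitzWith_ballSmoothing hG h).continuous
  set g : EuclideanSpace ℝ (Fin n) → ℝ :=
    fun u => ‖u - z‖ ^ 2 - 2 * ρ / n * (ballSmoothing G h u - ballSmoothing G h z) + ρ ^ 2 * M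
    with hg
  have hgc : Continuous g := by fun_prop
  have hYs : ∀ᵐ ω ∂P, Y ω ∈ Set.univ.pi fun _ : Fin K =>
      Metric.sphere (0 : EuclideanSpace ℝ (Fin n)) 1 := by
    have h1 := ae_pi_norm_eq_one (n := n) (K := K) hn
    rw [← hYl] at h1
    filter_upwards [ae_of_ae_map hY.aemeasurable h1] with ω hω
    simpa using hω
  have hΨi : Integrable (fun ω => Ψ (ξ ω, Y ω)) P :=
    integrable_comp_of_ae_mem_isCompact hΨc (hXc.prod isCompact_sphere_pi)
      (hξ.prodMk hY).aemeasurable (by filter_upwards [hYs] with ω hω using ⟨hξX ω, hω⟩)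
  have hlaw : P.map (fun ω => (ξ ω, Y ω)) =
      (P.map ξ).prod (Measure.pi fun _ : Fin K => sphereUniform n) := by
    rw [(indepFun_iff_map_prod_eq_prod_map_map hξ.aemeasurable hY.aemeasurable).1 hind, hYl]
  have hint : ∀ {f : EuclideanSpace ℝ (Fin n) → ℝ}, Continuous f →
      Integrable (fun ω => f (ξ ω)) P := fun hf =>
    integrable_comp_of_ae_mem_isCompact hf hXc hξ.aemeasurable (Eventually.of_forall hξX)
  have : IsProbabilityMeasure (P.map ξ) := Measure.isProbabilityMeasure_map hξ.aemeasurable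
  calc ∫ ω, ‖ξ' ω - z‖ ^ 2 ∂P ≤ ∫ ω, Ψ (ξ ω, Y ω) ∂P := by
        refine integral_mono_of_nonneg (Eventually.of_forall fun ω => sq_nonneg _) hΨi
          (Eventually.of_forall fun ω => ?_)
        exact pow_le_pow_left₀ (norm_nonneg _)
          ((hstep ω).norm_sub_le hX (isProjection_self hz)) 2
    _ = ∫ p, Ψ p ∂((P.map ξ).prod (Measure.pi fun _ : Fin K => sphereUniform n)) := by
        rw [← hlaw, integral_map (hξ.prodMk hY).aemeasurable hΨc.aestronglyMeasurable]
    _ = ∫ u, ∫ v, Ψ (u, v) ∂(Measure.pi fun _ : Fin K => sphereUniform n) ∂(P.map ξ) := by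
        refine integral_prod _ ?_
        rw [← hlaw, integrable_map_measure hΨc.aestronglyMeasurable (hξ.prodMk hY).aemeasurable]
        exact hΨi
    _ ≤ ∫ u, g u ∂(P.map ξ) := by
        refine integral_mono_of_nonneg
          (Eventually.of_forall fun u => integral_nonneg fun v => sq_nonneg _) ?_ ?_
        · rw [integrable_map_measure hgc.aestronglyMeasurable hξ.aemeasurable]
          exact hint hgc
        · have hae : ∀ᵐ u ∂(P.map ξ), u ∈ X := by
            exact (ae_map_iff (p := fun u => u ∈ X) hξ.aemeasurable hXc.isClosed.measurableSet).2
              (Eventually.of_forall hξX)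
          filter_upwards [hae] with u hu
          exact integral_pi_sq_norm_step_le hn hK hC hG hconv hh hρ (hU u hu) (hU z hz)
    _ = ∫ ω, g (ξ ω) ∂P := integral_map hξ.aemeasurable hgc.aestronglyMeasurable
    _ = _ := by
        have h1 : Integrable (fun ω => ‖ξ ω - z‖ ^ 2) P :=
          hint (f := fun u => ‖u - z‖ ^ 2) (by fun_prop)
        have h2 : Integrable (fun ω => ballSmoothing G h (ξ ω) - ballSmoothing G h z) P :=
          hint (f := fun u => ballSmoothing G h u - ballSmoothing G h z) (by fun_prop)
        have h3 : Integrable (fun ω => ‖ξ ω - z‖ ^ 2 -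
            2 * ρ / n * (ballSmoothing G h (ξ ω) - ballSmoothing G h z)) P :=
          h1.sub (h2.const_mul _)
        simp only [hg]
        rw [integral_add h3 (integrable_const _), integral_sub h1 (h2.const_mul _),
          integral_const_mul]
        simp

/-- Weighted sum of the expected gaps of the smoothed functions along a measurable trajectory. -/
theorem sum_expected_gap_le [IsProbabilityMeasure P] (hn : 1 ≤ n) (hK : 1 ≤ K) {C : ℝ}
    (hC : IsDifferenceConstant C) {L : ℝ≥0} {G : EuclideanSpace ℝ (Fin n) → ℝ}
    (hG : LipschitzWith L G) {U X : Set (EuclideanSpace ℝ (Fin n))} (hconv : ConvexOn ℝ U G)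
    (hX : Convex ℝ X) (hXc : IsCompact X) {ρ h : ℕ → ℝ} (hh : ∀ s, 0 < h s)
    (hU : ∀ s, ∀ u ∈ X, Metric.closedBall u (h s) ⊆ U) (hρ : ∀ s, 0 ≤ ρ s)
    {Y : ℕ × Fin K → Ω → EuclideanSpace ℝ (Fin n)} (hYm : ∀ i, Measurable (Y i))
    (hYl : ∀ i, P.map (Y i) = sphereUniform n) (hYi : iIndepFun Y P)
    {p : EuclideanSpace ℝ (Fin n) → EuclideanSpace ℝ (Fin n)} (hpc : Continuous p)
    (hp : ∀ z, IsProjection X z (p z)) {x₁ : EuclideanSpace ℝ (Fin n)} (hx₁ : x₁ ∈ X)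
    {x : ℕ → Ω → EuclideanSpace ℝ (Fin n)} (h0 : ∀ ω, x 0 ω = x₁)
    (hs : ∀ s ω, x (s + 1) ω =
      p (x s ω - ρ s • batchDirection G (h s) (x s ω) fun k => Y (s, k) ω)) :
    (∀ s, Measurable (x s)) ∧ (∀ s ω, x s ω ∈ X) ∧ ∀ z ∈ X, ∀ T : ℕ,
      ∑ s ∈ Finset.range T, 2 * ρ s / n *
        ∫ ω, (ballSmoothing G (h s) (x s ω) - ballSmoothing G (h s) z) ∂P ≤
      ‖x₁ - z‖ ^ 2 +
        ∑ s ∈ Finset.range T, ρ s ^ 2 * ((L : ℝ) ^ 2 / (n * K) * (C + K / n)) := by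
  have hfm : ∀ s, Measurable fun q : EuclideanSpace ℝ (Fin n) × (Fin K → EuclideanSpace ℝ (Fin n))
      => p (q.1 - ρ s • batchDirection G (h s) q.1 q.2) := fun s => by
    have := continuous_batchDirection (K := K) hG.continuous (h s)
    exact (by fun_prop : Continuous fun q : EuclideanSpace ℝ (Fin n) ×
      (Fin K → EuclideanSpace ℝ (Fin n)) =>
        p (q.1 - ρ s • batchDirection G (h s) q.1 q.2)).measurable
  have hrec := indepFun_of_recursion hYm hYi hfm h0 hs
  have hxX : ∀ s ω, x s ω ∈ X := fun s ω => by
    cases s with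
    | zero => rw [h0]; exact hx₁
    | succ s => rw [hs]; exact (hp _).1
  refine ⟨fun s => (hrec s).1, hxX, fun z hz T => ?_⟩
  have hlaw : ∀ s, P.map (fun ω k => Y (s, k) ω) =
      Measure.pi fun _ : Fin K => sphereUniform n := fun s => by
    have hinj : Function.Injective fun k : Fin K => (s, k) := fun a b hab => by simpa using hab
    rw [(iIndepFun_iff_map_fun_eq_pi_map fun k => (hYm (s, k)).aemeasurable).1 (hYi.precomp hinj)]
    simp_rw [hYl]
  have hstep : ∀ s, 2 * ρ s / n *
        ∫ ω, (ballSmoothing G (h s) (x s ω) - ballSmoothing G (h s) z) ∂P ≤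
      ∫ ω, ‖x s ω - z‖ ^ 2 ∂P - ∫ ω, ‖x (s + 1) ω - z‖ ^ 2 ∂P +
        ρ s ^ 2 * ((L : ℝ) ^ 2 / (n * K) * (C + K / n)) := fun s => by
    have := integral_sq_norm_sub_step_le hn hK hC hG hconv hX hXc (hh s) (hU s) (hρ s)
      (hrec s).1 (hxX s) (measurable_pi_lambda _ fun k => hYm (s, k)) (hlaw s)
      (hrec s).2 (ξ' := x (s + 1)) (fun ω => by rw [hs]; exact hp _) hz
    linarith
  calc _ ≤ ∑ s ∈ Finset.range T, (∫ ω, ‖x s ω - z‖ ^ 2 ∂P - ∫ ω, ‖x (s + 1) ω - z‖ ^ 2 ∂P +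
        ρ s ^ 2 * ((L : ℝ) ^ 2 / (n * K) * (C + K / n))) :=
        Finset.sum_le_sum fun s _ => hstep s
    _ = ‖x₁ - z‖ ^ 2 - ∫ ω, ‖x T ω - z‖ ^ 2 ∂P +
        ∑ s ∈ Finset.range T, ρ s ^ 2 * ((L : ℝ) ^ 2 / (n * K) * (C + K / n)) := by
        rw [Finset.sum_add_distrib, Finset.sum_range_sub' fun s => ∫ ω, ‖x s ω - z‖ ^ 2 ∂P]
        simp [h0]
    _ ≤ _ := by
        have : 0 ≤ ∫ ω, ‖x T ω - z‖ ^ 2 ∂P := integral_nonneg fun ω => sq_nonneg _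
        linarith

end Trajectory

/-! ### The error of the averaged trajectory -/

section AveragedTrajectory

variable {n K : ℕ}

theorem batchDirection_congr {F G : EuclideanSpace ℝ (Fin n) → ℝ} {h : ℝ} (hh : 0 ≤ h)
    {u : EuclideanSpace ℝ (Fin n)} (hFG : Set.EqOn F G (Metric.closedBall u h))
    {v : Fin K → EuclideanSpace ℝ (Fin n)} (hv : ∀ k, ‖v k‖ = 1) :
    batchDirection F h u v = batchDirection G h u v := by
  unfold batchDirection centralDifference
  refine congrArg _ (Finset.sum_congr rfl fun k _ => ?_)
  have h1 := hFG (add_smul_mem_closedBall hh u (hv k).le)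
  have h2 := hFG (add_smul_mem_closedBall hh u (y := -v k) (by rw [norm_neg]; exact (hv k).le))
  rw [smul_neg, ← sub_eq_add_neg] at h2
  rw [h1, h2]

theorem sum_Icc_one_eq_sum_range {H : Type*} [AddCommMonoid H] (f : ℕ → H) (T : ℕ) :
    ∑ t ∈ Finset.Icc 1 T, f t = ∑ s ∈ Finset.range T, f (s + 1) := by
  induction T with
  | zero => simp
  | succ T ih => rw [Finset.sum_Icc_succ_top (by omega), Finset.sum_range_succ, ih]

/-- Expected gap of `Q` at the averaged trajectory, when on `X` the gap of `Q` is at most that of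
the smoothed function plus `ε t`. The function `F` may be arbitrary outside `U`, so the
trajectory itself is only almost everywhere equal to a measurable process, driven by a Lipschitz
extension of `F`. -/
theorem expected_gap_trajectoryAverage_le {Ω : Type*} [MeasurableSpace Ω] {P : Measure Ω}
    [IsProbabilityMeasure P] (hn : 1 ≤ n) (hK : 1 ≤ K) {C : ℝ}
    (hC : IsDifferenceConstant C) {L : ℝ≥0} {F : EuclideanSpace ℝ (Fin n) → ℝ}
    {X U : Set (EuclideanSpace ℝ (Fin n))} (hX : Convex ℝ X) (hXc : IsCompact X)
    (hconv : ConvexOn ℝ U F) (hlip : LipschitzOnWith L F U) {ρ h : ℕ → ℝ}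
    (hρ : ∀ t, 1 ≤ t → 0 < ρ t) (hh : ∀ t, 1 ≤ t → 0 < h t)
    (hU : ∀ t, 1 ≤ t → Metric.cthickening (h t) X ⊆ U)
    {y : ℕ → Fin K → Ω → EuclideanSpace ℝ (Fin n)} (hy : IsDirectionSample P y)
    {x₁ : EuclideanSpace ℝ (Fin n)} (hx₁ : x₁ ∈ X) {x : ℕ → Ω → EuclideanSpace ℝ (Fin n)}
    (hx : IsTrajectory X F ρ h y x₁ x) {Q : EuclideanSpace ℝ (Fin n) → ℝ}
    (hQc : ConvexOn ℝ X Q) (hQl : LipschitzOnWith L Q X) {z : EuclideanSpace ℝ (Fin n)}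
    (hz : z ∈ X) {ε : ℕ → ℝ} (hε : ∀ t, 1 ≤ t → ∀ u ∈ X,
      Q u - Q z ≤ ballSmoothing F (h t) u - ballSmoothing F (h t) z + ε t) {T : ℕ} (hT : 1 ≤ T) :
    Integrable (fun ω => Q (trajectoryAverage ρ x T ω)) P ∧
      ∫ ω, Q (trajectoryAverage ρ x T ω) ∂P - Q z ≤
        n / 2 * (‖x₁ - z‖ ^ 2 + ∑ t ∈ Finset.Icc 1 T,
          (ρ t ^ 2 * ((L : ℝ) ^ 2 / (n * K) * (C + K / n)) + 2 / n * (ρ t * ε t))) /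
          ∑ t ∈ Finset.Icc 1 T, ρ t := by
  have hn' : (0 : ℝ) < n := by exact_mod_cast hn
  obtain ⟨G, hGl, hFG⟩ := hlip.extend_real
  have hGconv : ConvexOn ℝ U G := hconv.congr hFG
  obtain ⟨Q', hQ'l, hQQ'⟩ := hQl.extend_real
  have hball : ∀ s, ∀ u ∈ X, Metric.closedBall u (h (s + 1)) ⊆ U := fun s u hu =>
    (Metric.closedBall_subset_cthickening hu _).trans (hU _ (by omega))
  have hhs : ∀ s, 0 < h (s + 1) := fun s => hh _ (by omega)
  have hρs : ∀ s, 0 < ρ (s + 1) := fun s => hρ _ (by omega)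
  -- A measurable version of the directions and the trajectory that it drives.
  have hlaw : ∀ i : ℕ × Fin K, HasLaw (y (i.1 + 1) i.2) (sphereUniform n) P := fun i =>
    hy.hasLaw _ (by omega) i.2
  set Y : ℕ × Fin K → Ω → EuclideanSpace ℝ (Fin n) := fun i => (hlaw i).aemeasurable.mk _ with hY
  have hYm : ∀ i, Measurable (Y i) := fun i => (hlaw i).aemeasurable.measurable_mk
  have hYe : ∀ i : ℕ × Fin K, y (i.1 + 1) i.2 =ᵐ[P] Y i := fun i => (hlaw i).aemeasurable.ae_eq_mk
  have hYl : ∀ i, P.map (Y i) = sphereUniform n := fun i => by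
    rw [← (hlaw i).map_eq, Measure.map_congr (hYe i)]
  have hYi : iIndepFun Y P := hy.indep.congr hYe
  obtain ⟨p, hpc, hp⟩ := exists_continuous_isProjection hX hXc ⟨x₁, hx₁⟩
  let x' : ℕ → Ω → EuclideanSpace ℝ (Fin n) := fun s ω => Nat.rec x₁ (fun s u =>
    p (u - ρ (s + 1) • batchDirection G (h (s + 1)) u fun k => Y (s, k) ω)) s
  obtain ⟨hxm, hxX, hsum⟩ := sum_expected_gap_le (ρ := fun s => ρ (s + 1))
    (h := fun s => h (s + 1)) (x := x') hn hK hC hGl hGconv hX hXc hhs hball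
    (fun s => (hρs s).le) hYm hYl hYi hpc hp hx₁ (fun _ => rfl) (fun _ _ => rfl)
  have hxx' : ∀ᵐ ω ∂P, ∀ s, x (s + 1) ω = x' s ω := by
    have h1 : ∀ᵐ ω ∂P, ∀ i : ℕ × Fin K, y (i.1 + 1) i.2 ω = Y i ω := ae_all_iff.2 hYe
    have h2 : ∀ᵐ ω ∂P, ∀ i : ℕ × Fin K, ‖Y i ω‖ = 1 := ae_all_iff.2 fun i => by
      have h3 := ae_norm_eq_one (n := n)
      rw [← hYl i] at h3
      exact ae_of_ae_map (hYm i).aemeasurable h3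
    filter_upwards [h1, h2] with ω hω1 hω2 s
    induction s with
    | zero => exact hx.start ω
    | succ s ih =>
      have h4 := hx.step (s + 1) (by omega) ω
      have h5 : (fun k => y (s + 1) k ω) = fun k => Y (s, k) ω := funext fun k => hω1 (s, k)
      rw [ih, h5, batchDirection_congr (hhs s).le (hFG.mono (hball s _ (hxX s ω)))
        fun k => hω2 (s, k)] at h4
      exact h4.eq hX (hp _)
  set R : ℝ := ∑ s ∈ Finset.range T, ρ (s + 1) with hR
  have hRpos : 0 < R := Finset.sum_pos (fun s _ => hρs s) ⟨0, by simp; omega⟩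
  set A : Ω → EuclideanSpace ℝ (Fin n) :=
    fun ω => ∑ s ∈ Finset.range T, (R⁻¹ * ρ (s + 1)) • x' s ω with hA
  have hAe : ∀ᵐ ω ∂P, trajectoryAverage ρ x T ω = A ω := by
    filter_upwards [hxx'] with ω hω
    simp only [trajectoryAverage, hA, sum_Icc_one_eq_sum_range, Finset.smul_sum, smul_smul, hω, hR]
  have hAm : Measurable A := Finset.measurable_fun_sum _ fun s _ => by
    exact (hxm s).const_smul (R⁻¹ * ρ (s + 1))
  have hw0 : ∀ s ∈ Finset.range T, 0 ≤ R⁻¹ * ρ (s + 1) := fun s _ =>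
    mul_nonneg (inv_nonneg.2 hRpos.le) (hρs s).le
  have hw1 : ∑ s ∈ Finset.range T, R⁻¹ * ρ (s + 1) = 1 := by
    rw [← Finset.mul_sum, inv_mul_cancel₀ hRpos.ne']
  have hAX : ∀ ω, A ω ∈ X := fun ω => hX.sum_mem hw0 hw1 fun s _ => hxX s ω
  have hintQ : ∀ {ξ : Ω → EuclideanSpace ℝ (Fin n)}, Measurable ξ → (∀ ω, ξ ω ∈ X) →
      Integrable (fun ω => Q (ξ ω)) P := fun {ξ} hξ hξX => by
    have h1 := integrable_comp_of_ae_mem_isCompact (P := P) hQ'l.continuous hXc hξ.aemeasurable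
      (Eventually.of_forall hξX)
    exact h1.congr (Eventually.of_forall fun ω => (hQQ' (hξX ω)).symm)
  have hQA : (fun ω => Q (A ω)) =ᵐ[P] fun ω => Q (trajectoryAverage ρ x T ω) := by
    filter_upwards [hAe] with ω hω
    rw [hω]
  refine ⟨(hintQ hAm hAX).congr hQA, ?_⟩
  rw [← integral_congr_ae hQA]
  have hgapi : ∀ s, Integrable (fun ω => ballSmoothing G (h (s + 1)) (x' s ω) -
      ballSmoothing G (h (s + 1)) z) P := fun s =>
    (integrable_comp_of_ae_mem_isCompact (lipschitzWith_ballSmoothing hGl _).continuous hXc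
      (hxm s).aemeasurable (Eventually.of_forall (hxX s))).sub (integrable_const _)
  have hFGs : ∀ s, ∀ u ∈ X, ballSmoothing F (h (s + 1)) u = ballSmoothing G (h (s + 1)) u :=
    fun s u hu => ballSmoothing_congr (hhs s).le (hFG.mono (hball s u hu))
  have hgap : ∀ s, ∫ ω, Q (x' s ω) ∂P - Q z ≤
      ∫ ω, (ballSmoothing G (h (s + 1)) (x' s ω) - ballSmoothing G (h (s + 1)) z) ∂P +
        ε (s + 1) := fun s => by
    have h1 : ∫ ω, Q (x' s ω) ∂P ≤ ∫ ω, ((ballSmoothing G (h (s + 1)) (x' s ω) -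
        ballSmoothing G (h (s + 1)) z) + (ε (s + 1) + Q z)) ∂P := by
      refine integral_mono (hintQ (hxm s) (hxX s)) ((hgapi s).add (integrable_const _)) fun ω => ?_
      have := hε (s + 1) (by omega) _ (hxX s ω)
      rw [hFGs s _ (hxX s ω), hFGs s z hz] at this
      simp only
      linarith
    rw [integral_add (hgapi s) (integrable_const _)] at h1
    simp only [integral_const, probReal_univ, one_smul] at h1
    linarith
  have hjensen : ∫ ω, Q (A ω) ∂P ≤ ∑ s ∈ Finset.range T, R⁻¹ * ρ (s + 1) * ∫ ω, Q (x' s ω) ∂P := by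
    have h1 : ∀ s ∈ Finset.range T, Integrable (fun ω => R⁻¹ * ρ (s + 1) * Q (x' s ω)) P :=
      fun s _ => (hintQ (hxm s) (hxX s)).const_mul _
    simp_rw [← integral_const_mul]
    rw [← integral_finsetSum _ h1]
    refine integral_mono (hintQ hAm hAX) (integrable_finsetSum _ h1) fun ω => ?_
    exact hQc.map_sum_le hw0 hw1 fun s _ => hxX s ω
  have hsumz := hsum z hz T
  rw [sum_Icc_one_eq_sum_range, sum_Icc_one_eq_sum_range, ← hR, le_div_iff₀ hRpos]
  set M : ℝ := (L : ℝ) ^ 2 / (n * K) * (C + K / n) with hM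
  set g : ℕ → ℝ := fun s => ∫ ω, (ballSmoothing G (h (s + 1)) (x' s ω) -
    ballSmoothing G (h (s + 1)) z) ∂P with hg
  have h2 : (∫ ω, Q (A ω) ∂P - Q z) * R ≤ ∑ s ∈ Finset.range T, ρ (s + 1) * (g s + ε (s + 1)) := by
    have h3 : (∫ ω, Q (A ω) ∂P - Q z) ≤
        ∑ s ∈ Finset.range T, R⁻¹ * ρ (s + 1) * (∫ ω, Q (x' s ω) ∂P - Q z) := by
      simp_rw [mul_sub]
      rw [Finset.sum_sub_distrib, ← Finset.sum_mul, hw1, one_mul]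
      linarith
    calc _ ≤ (∑ s ∈ Finset.range T, R⁻¹ * ρ (s + 1) * (∫ ω, Q (x' s ω) ∂P - Q z)) * R := by
          gcongr
      _ = ∑ s ∈ Finset.range T, ρ (s + 1) * (∫ ω, Q (x' s ω) ∂P - Q z) := by
          rw [Finset.sum_mul]
          refine Finset.sum_congr rfl fun s _ => ?_
          field_simp
      _ ≤ _ := Finset.sum_le_sum fun s _ => mul_le_mul_of_nonneg_left (hgap s) (hρs s).le
  refine h2.trans ?_
  have h4 : ∑ s ∈ Finset.range T, ρ (s + 1) * (g s + ε (s + 1)) =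
      n / 2 * (∑ s ∈ Finset.range T, 2 * ρ (s + 1) / n * g s +
        ∑ s ∈ Finset.range T, 2 / n * (ρ (s + 1) * ε (s + 1))) := by
    rw [← Finset.sum_add_distrib, Finset.mul_sum]
    refine Finset.sum_congr rfl fun s _ => ?_
    field_simp
  rw [h4, Finset.sum_add_distrib, ← add_assoc]
  gcongr

theorem convexOn_lipschitzOn_ballSmoothing {L : ℝ≥0} {F : EuclideanSpace ℝ (Fin n) → ℝ}
    {X U : Set (EuclideanSpace ℝ (Fin n))} (hX : Convex ℝ X) (hconv : ConvexOn ℝ U F)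
    (hlip : LipschitzOnWith L F U) {h : ℝ} (hh : 0 ≤ h) (hU : Metric.cthickening h X ⊆ U) :
    ConvexOn ℝ X (ballSmoothing F h) ∧ LipschitzOnWith L (ballSmoothing F h) X := by
  obtain ⟨G, hGl, hFG⟩ := hlip.extend_real
  have hball : ∀ u ∈ X, Metric.closedBall u h ⊆ U := fun u hu =>
    (Metric.closedBall_subset_cthickening hu _).trans hU
  have he : Set.EqOn (ballSmoothing G h) (ballSmoothing F h) X := fun u hu =>
    (ballSmoothing_congr hh (hFG.mono (hball u hu))).symm
  refine ⟨(convexOn_ballSmoothing hGl.continuous (hconv.congr hFG) hX hh hball).congr he, ?_⟩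
  intro u hu v hv
  rw [← he hu, ← he hv]
  exact lipschitzWith_ballSmoothing hGl h u v

/-- On `X`, the gap of `F` exceeds that of its smoothing by at most `L h`. -/
theorem sub_le_ballSmoothing_sub_add {L : ℝ≥0} {F : EuclideanSpace ℝ (Fin n) → ℝ}
    {X U : Set (EuclideanSpace ℝ (Fin n))} (hconv : ConvexOn ℝ U F)
    (hlip : LipschitzOnWith L F U) {h : ℝ} (hh : 0 ≤ h) (hU : Metric.cthickening h X ⊆ U)
    {u z : EuclideanSpace ℝ (Fin n)} (hu : u ∈ X) (hz : z ∈ X) :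
    F u - F z ≤ ballSmoothing F h u - ballSmoothing F h z + L * h := by
  obtain ⟨G, hGl, hFG⟩ := hlip.extend_real
  have hball : ∀ u ∈ X, Metric.closedBall u h ⊆ U := fun u hu =>
    (Metric.closedBall_subset_cthickening hu _).trans hU
  have h1 := le_ballSmoothing hGl.continuous (hconv.congr hFG) hh (hball u hu)
  have h2 := ballSmoothing_le_add hGl hh z
  rw [ballSmoothing_congr hh (hFG.mono (hball u hu)), ballSmoothing_congr hh
    (hFG.mono (hball z hz)), hFG (hball u hu (Metric.mem_closedBall_self hh)),
    hFG (hball z hz (Metric.mem_closedBall_self hh))]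
  linarith

theorem trajectoryAverage_const {Ω : Type*} {c : ℝ} (hc : c ≠ 0)
    (x : ℕ → Ω → EuclideanSpace ℝ (Fin n)) (T : ℕ) (ω : Ω) :
    trajectoryAverage (fun _ => c) x T ω = (1 / (T : ℝ)) • ∑ t ∈ Finset.Icc 1 T, x t ω := by
  rw [trajectoryAverage, ← Finset.smul_sum, smul_smul]
  congr 1
  simp only [Finset.sum_const, Nat.card_Icc, add_tsub_cancel_right, nsmul_eq_mul, mul_inv, one_div]
  rw [mul_assoc, inv_mul_cancel₀ hc, mul_one]

theorem expectedErrorLE_of_isMinOn {Ω : Type*} [MeasurableSpace Ω] {P : Measure Ω}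
    {G : EuclideanSpace ℝ (Fin n) → ℝ} {X : Set (EuclideanSpace ℝ (Fin n))}
    {z : EuclideanSpace ℝ (Fin n)} (hz : z ∈ X) (hmin : IsMinOn G X z)
    {ξ : Ω → EuclideanSpace ℝ (Fin n)} {b : ℝ} (hi : Integrable (fun ω => G (ξ ω)) P)
    (hb : ∫ ω, G (ξ ω) ∂P - G z ≤ b) : ExpectedErrorLE P G X ξ b := by
  refine ⟨hi, G z, ⟨⟨z, hz, rfl⟩, ?_⟩, hb⟩
  rintro _ ⟨u, hu, rfl⟩
  exact hmin hu

end AveragedTrajectory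

/-! ### Numerical estimates -/

section Numerics

theorem two_mul_sqrt_sub_le_sum_inv_sqrt {T : ℕ} (hT : 1 ≤ T) :
    2 * √(T : ℝ) - 3 / 2 ≤ ∑ t ∈ Finset.Icc 1 T, 1 / √(t : ℝ) := by
  -- The trapezoidal rule for the convex function `1 / √s` yields an inductive bound.
  have key : 2 * √(T : ℝ) - 3 / 2 + 1 / (2 * √(T : ℝ)) ≤ ∑ t ∈ Finset.Icc 1 T, 1 / √(t : ℝ) := by
    induction T, hT using Nat.le_induction with
    | base => norm_num
    | succ T hT ih =>
      rw [Finset.sum_Icc_succ_top (by omega)]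
      have hT' : (0 : ℝ) < T := by exact_mod_cast hT
      set a := √(T : ℝ) with ha
      set b := √((T + 1 : ℕ) : ℝ) with hb
      have ha0 : 0 < a := Real.sqrt_pos.2 hT'
      have hb0 : 0 < b := Real.sqrt_pos.2 (by positivity)
      have hab : b ^ 2 - a ^ 2 = 1 := by
        rw [ha, hb, Real.sq_sqrt hT'.le, Real.sq_sqrt (by positivity)]
        push_cast
        ring
      have h1 : 2 * (b - a) ≤ (a + b) / (2 * (a * b)) := by
        have h2 : 2 * (b - a) = 2 / (a + b) := by
          rw [eq_div_iff (by positivity)]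
          nlinarith
        rw [h2, div_le_div_iff₀ (by positivity) (by positivity)]
        nlinarith [sq_nonneg (a - b)]
      have h3 : (a + b) / (2 * (a * b)) = 1 / (2 * a) + 1 / (2 * b) := by
        field_simp
        ring
      have h4 : 1 / b = 1 / (2 * b) + 1 / (2 * b) := by
        field_simp
        norm_num
      linarith
  have : (0 : ℝ) ≤ 1 / (2 * √(T : ℝ)) := by positivity
  linarith

theorem sum_inv_le_one_add_log (T : ℕ) :
    ∑ t ∈ Finset.Icc 1 T, 1 / (t : ℝ) ≤ 1 + Real.log T := by
  have := harmonic_le_one_add_log T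
  rw [harmonic_eq_sum_Icc] at this
  push_cast at this
  simpa [one_div] using this

/-- The inequality `1 - 1 / u ≤ log u` at `u = √T`. -/
theorem two_mul_sqrt_sub_one_le_log {T : ℕ} (hT : 1 ≤ T) :
    2 * (√(T : ℝ) - 1) ≤ Real.log T * √(T : ℝ) := by
  have hT' : (0 : ℝ) < T := by exact_mod_cast hT
  have hu : 0 < √(T : ℝ) := Real.sqrt_pos.2 hT'
  have h1 := Real.one_sub_inv_le_log_of_pos hu
  rw [Real.log_sqrt hT'.le] at h1
  have h2 := mul_le_mul_of_nonneg_right h1 hu.le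
  rw [sub_mul, inv_mul_cancel₀ hu.ne', one_mul] at h2
  linarith

/-- With `w = √t - 1`, `l = log t` and `r = √(1 + 2 / (C + K / n))`, the inequality between
constants behind the bound for decreasing smoothing parameters. The difference of the two sides
is concave in `r`, so that it suffices to check the ends of the range of `r`. The decimals round up
`√2 / 2` and `√3`. -/
theorem decreasing_smoothing_numeric {w l r : ℝ} (hw : 0 ≤ w) (hl0 : 0 ≤ l)
    (hl : 2 * w ≤ l * (w + 1)) (hr1 : 1 ≤ r) (hr2 : r ≤ 1.7321) :
    0.70715 * (4 + r ^ 2 * (1 + l) / 2) * w ≤ r * (2 + l) * (w + 1 / 4) := by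
  have hw1 : 0 < w + 1 := by linarith
  have e1 : 0 ≤ w * (0.6464 * l - 1.1822) + 0.5 + 0.25 * l := by
    refine nonneg_of_mul_nonneg_left ?_ hw1
    nlinarith [mul_le_mul_of_nonneg_left hl hw, sq_nonneg (w - 0.8)]
  have e2 : 0 ≤ w * (0.6713 * l - 0.4252) + 0.866 + 0.433 * l := by
    refine nonneg_of_mul_nonneg_left ?_ hw1
    nlinarith [mul_le_mul_of_nonneg_left hl hw, sq_nonneg (w - 0.8)]
  have h1 := mul_nonneg (sub_nonneg.2 hr2) e1
  have h2 := mul_nonneg (sub_nonneg.2 hr1) e2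
  have h3 : 0 ≤ (r - 1) * (1.7321 - r) := mul_nonneg (sub_nonneg.2 hr1) (sub_nonneg.2 hr2)
  have h4 := mul_nonneg (mul_nonneg h3 hw) hl0
  have h5 := mul_nonneg h3 hw
  nlinarith

end Numerics

/-! ### Constants in the bounds -/

section Constants

/-- The square root of the bound `L² / (nK) * (C + K / n)` for the second moment of the batch
direction. -/
noncomputable def batchScale (n K : ℕ) (L C : ℝ) : ℝ := L * √(C + K / n) / √(n * K)

variable {n K : ℕ} {L D C : ℝ}

theorem batchScale_pos (hn : 1 ≤ n) (hK : 1 ≤ K) (hL : 0 < L) (hC : 1 ≤ C) :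
    0 < batchScale n K L C := by
  have hn' : (0 : ℝ) < n := by exact_mod_cast hn
  have hK' : (0 : ℝ) < K := by exact_mod_cast hK
  unfold batchScale
  positivity

theorem sq_batchScale (hC : 1 ≤ C) :
    L ^ 2 / (n * K) * (C + K / n) = batchScale n K L C ^ 2 := by
  rw [batchScale, div_pow, mul_pow, Real.sq_sqrt (by positivity), Real.sq_sqrt (by positivity)]
  ring

/-- The step at time `s` is `D / (√2 M √s)` with `M` the batch scale. -/
theorem stepSize_eq (hC : 1 ≤ C) (s : ℝ) (hs : 0 ≤ s) :
    stepSize n K L D C s = D / (√2 * batchScale n K L C) / √s := by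
  rw [stepSize, batchScale, Real.sqrt_mul (by positivity : 0 ≤ 2 * s), Real.sqrt_mul zero_le_two s]
  field_simp

theorem bound_eq (hn : 1 ≤ n) (hK : 1 ≤ K) :
    L * √((n : ℝ) / K) * √(C + K / n) = n * batchScale n K L C := by
  have hn' : (0 : ℝ) < n := by exact_mod_cast hn
  have hK' : (0 : ℝ) < K := by exact_mod_cast hK
  rw [batchScale, Real.sqrt_mul hn'.le, Real.sqrt_div hn'.le]
  have h2 : 0 < √(n : ℝ) := Real.sqrt_pos.2 hn'
  have h3 : 0 < √(K : ℝ) := Real.sqrt_pos.2 hK'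
  have h4 : √(n : ℝ) ^ 2 = n := Real.sq_sqrt hn'.le
  generalize √(C + (K : ℝ) / n) = a
  field_simp
  rw [h4]
  ring

/-- The bound for constant steps, from the general bound on the averaged trajectory. -/
theorem constant_step_bound_le (hn : 1 ≤ n) (hK : 1 ≤ K) (hL : 0 < L) (hD : 0 < D) (hC : 1 ≤ C)
    {T : ℕ} (hT : 1 ≤ T) {d c : ℝ} (hd : d ^ 2 / 2 + D ^ 2 / 4 ≤ c * D ^ 2) :
    n / 2 * (d ^ 2 + ∑ _t ∈ Finset.Icc 1 T,
      (stepSize n K L D C T ^ 2 * (L ^ 2 / (n * K) * (C + K / n)) +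
        2 / n * (stepSize n K L D C T * 0))) / ∑ _t ∈ Finset.Icc 1 T, stepSize n K L D C T ≤
      c * (L * D / √T * √(2 * n / K) * √(C + (K : ℝ) / n)) := by
  have hn' : (0 : ℝ) < n := by exact_mod_cast hn
  have hT' : (0 : ℝ) < T := by exact_mod_cast hT
  have hb : L * D / √(T : ℝ) * √(2 * n / K) * √(C + (K : ℝ) / n) =
      n * batchScale n K L C * D * √2 / √(T : ℝ) := by
    rw [← bound_eq hn hK, mul_div_assoc 2, Real.sqrt_mul (by norm_num)]
    ring
  have hM := batchScale_pos hn hK hL hC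
  rw [hb, sq_batchScale hC, stepSize_eq hC _ hT'.le]
  set M := batchScale n K L C
  have hu : 0 < √(T : ℝ) := Real.sqrt_pos.2 hT'
  have h2 : 0 < √(2 : ℝ) := by positivity
  have huu : (T : ℝ) = √(T : ℝ) ^ 2 := (Real.sq_sqrt hT'.le).symm
  have h22 : √(2 : ℝ) ^ 2 = 2 := Real.sq_sqrt (by norm_num)
  simp only [mul_zero, add_zero, Finset.sum_const, Nat.card_Icc, add_tsub_cancel_right,
    nsmul_eq_mul]
  have e1 : (T : ℝ) * ((D / (√2 * M) / √(T : ℝ)) ^ 2 * M ^ 2) = D ^ 2 / 2 := by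
    rw [div_pow, div_pow, mul_pow, h22, ← huu]
    field_simp
  have e2 : (T : ℝ) * (D / (√2 * M) / √(T : ℝ)) = D * √(T : ℝ) / (√2 * M) := by
    nth_rewrite 1 [huu]
    field_simp
  rw [e1, e2, div_le_iff₀ (by positivity)]
  have e3 : c * (n * M * D * √2 / √(T : ℝ)) * (D * √(T : ℝ) / (√2 * M)) = n * (c * D ^ 2) := by
    field_simp
  rw [e3]
  calc _ = n * (d ^ 2 / 2 + D ^ 2 / 4) := by ring
    _ ≤ _ := by gcongr

/-- Common form of the bounds for decreasing steps. The factor `κ` is the ratio of the error per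
step, smoothing error included, to the second moment of the step alone. -/
theorem decreasing_step_bound_le (hn : 1 ≤ n) (hK : 1 ≤ K) (hL : 0 < L) (hD : 0 < D) (hC : 1 ≤ C)
    {T : ℕ} (hT : 2 ≤ T) {d κ c : ℝ} (hd : d ^ 2 ≤ 4 * D ^ 2) (hκ : 0 ≤ κ) (hc0 : 0 ≤ c)
    (hc : √2 * (4 + κ * (1 + Real.log T) / 2) * (√(T : ℝ) - 1) ≤
      c * (2 + Real.log T) * (2 * √(T : ℝ) - 3 / 2)) {ε : ℕ → ℝ}
    (hε : ∀ t : ℕ, 1 ≤ t → stepSize n K L D C t ^ 2 * (L ^ 2 / (n * K) * (C + K / n)) +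
      2 / n * (stepSize n K L D C t * ε t) = κ * (D ^ 2 / 2) * (1 / t)) :
    n / 2 * (d ^ 2 + ∑ t ∈ Finset.Icc 1 T,
      (stepSize n K L D C t ^ 2 * (L ^ 2 / (n * K) * (C + K / n)) +
        2 / n * (stepSize n K L D C t * ε t))) / ∑ t ∈ Finset.Icc 1 T, stepSize n K L D C t ≤
      n * batchScale n K L C * D * (c / 2) * ((2 + Real.log T) / (√(T : ℝ) - 1)) := by
  have hn' : (0 : ℝ) < n := by exact_mod_cast hn
  have hM := batchScale_pos hn hK hL hC
  have hT' : (2 : ℝ) ≤ T := by exact_mod_cast hT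
  have hl0 : 0 ≤ Real.log T := Real.log_nonneg (by linarith)
  have hu : 0 < √(T : ℝ) - 1 := by
    have : √(1 : ℝ) < √(T : ℝ) := Real.sqrt_lt_sqrt (by norm_num) (by linarith)
    rw [Real.sqrt_one] at this
    linarith
  have h2 : 0 < √(2 : ℝ) := by positivity
  have e1 : ∑ t ∈ Finset.Icc 1 T, (stepSize n K L D C t ^ 2 * (L ^ 2 / (n * K) * (C + K / n)) +
      2 / n * (stepSize n K L D C t * ε t)) =
      κ * (D ^ 2 / 2) * ∑ t ∈ Finset.Icc 1 T, 1 / (t : ℝ) := by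
    rw [Finset.mul_sum]
    exact Finset.sum_congr rfl fun t ht => hε t (Finset.mem_Icc.1 ht).1
  have e2 : ∑ t ∈ Finset.Icc 1 T, stepSize n K L D C t =
      D / (√2 * batchScale n K L C) * ∑ t ∈ Finset.Icc 1 T, 1 / √(t : ℝ) := by
    rw [Finset.mul_sum]
    refine Finset.sum_congr rfl fun t _ => ?_
    rw [stepSize_eq hC _ (Nat.cast_nonneg t), mul_one_div]
  have hH := sum_inv_le_one_add_log T
  have hS := two_mul_sqrt_sub_le_sum_inv_sqrt (T := T) (by omega)
  rw [e1, e2]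
  set M := batchScale n K L C
  set H := ∑ t ∈ Finset.Icc 1 T, 1 / (t : ℝ)
  set S := ∑ t ∈ Finset.Icc 1 T, 1 / √(t : ℝ)
  set l := Real.log T
  set u := √(T : ℝ)
  have hSpos : 0 < S := by linarith
  rw [div_le_iff₀ (by positivity)]
  have e3 : n * M * D * (c / 2) * ((2 + l) / (u - 1)) * (D / (√2 * M) * S) =
      n / 2 * D ^ 2 * (c * (2 + l) * S / (√2 * (u - 1))) := by
    field_simp
  rw [e3]
  have e4 : 4 + κ * H / 2 ≤ c * (2 + l) * S / (√2 * (u - 1)) := by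
    rw [le_div_iff₀ (by positivity)]
    calc (4 + κ * H / 2) * (√2 * (u - 1)) ≤ (4 + κ * (1 + l) / 2) * (√2 * (u - 1)) := by gcongr
      _ = √2 * (4 + κ * (1 + l) / 2) * (u - 1) := by ring
      _ ≤ _ := hc
      _ ≤ _ := by gcongr
  have e5 := mul_le_mul_of_nonneg_left e4 (sq_nonneg D)
  have e6 : (0 : ℝ) ≤ n / 2 := by positivity
  calc _ ≤ (n : ℝ) / 2 * (D ^ 2 * (c * (2 + l) * S / (√2 * (u - 1)))) :=
        mul_le_mul_of_nonneg_left (by linarith) e6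
    _ = _ := by ring

end Constants

theorem theorem2 :
    (∃ C : ℝ, IsDifferenceConstant C) ∧
    ∀ (C : ℝ), IsDifferenceConstant C →
    ∀ (n K : ℕ), 1 ≤ n → 1 ≤ K →
    ∀ (L : ℝ≥0) (D : ℝ), 0 < L → 0 < D →
    ∀ (X U : Set (EuclideanSpace ℝ (Fin n))) (F : EuclideanSpace ℝ (Fin n) → ℝ),
      Convex ℝ X → IsCompact X → (∀ x ∈ X, ‖x‖ ≤ D) →
      ConvexOn ℝ U F → LipschitzOnWith L F U →
    ∀ {Ω : Type*} [MeasurableSpace Ω] (P : Measure Ω) [IsProbabilityMeasure P]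
      (y : ℕ → Fin K → Ω → EuclideanSpace ℝ (Fin n)), IsDirectionSample P y →
    ∀ x₁ ∈ X, ∀ (x : ℕ → Ω → EuclideanSpace ℝ (Fin n)),
      -- constant step and constant smoothing parameter
      (∀ (h : ℝ), 0 < h → Metric.cthickening h X ⊆ U →
        ∀ (T : ℕ), 1 ≤ T →
        IsTrajectory X F (fun _ => stepSize n K L D C T) (fun _ => h) y x₁ x →
        ExpectedErrorLE P (ballSmoothing F h) X
            (fun ω => (1 / (T : ℝ)) • ∑ t ∈ Finset.Icc 1 T, x t ω)
            (5 / 2 * (L * D / √T * √(2 * n / K) * √(C + (K : ℝ) / n))) ∧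
        ((∃ z ∈ X, IsMinOn (ballSmoothing F h) X z ∧ ‖x₁ - z‖ ≤ D) →
          ExpectedErrorLE P (ballSmoothing F h) X
            (fun ω => (1 / (T : ℝ)) • ∑ t ∈ Finset.Icc 1 T, x t ω)
            (L * D / √T * √(2 * n / K) * √(C + (K : ℝ) / n)))) ∧
      -- variable steps and constant smoothing parameter
      (∀ (h : ℝ), 0 < h → Metric.cthickening h X ⊆ U →
        IsTrajectory X F (fun t => stepSize n K L D C t) (fun _ => h) y x₁ x →
        ∀ (t : ℕ), 2 ≤ t →
        ExpectedErrorLE P (ballSmoothing F h) X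
          (trajectoryAverage (fun τ => stepSize n K L D C τ) x t)
          (D * L / √2 * √((n : ℝ) / K) * √(C + (K : ℝ) / n) *
            ((2 + Real.log t) / (√t - 1)))) ∧
      -- variable steps and variable smoothing parameters
      ((∀ (t : ℕ), 1 ≤ t → Metric.cthickening (L * stepSize n K L D C t / K) X ⊆ U) →
        IsTrajectory X F (fun t => stepSize n K L D C t)
          (fun t => L * stepSize n K L D C t / K) y x₁ x →
        ∀ (t : ℕ), 2 ≤ t →
        ExpectedErrorLE P F X
          (trajectoryAverage (fun τ => stepSize n K L D C τ) x t)
          (D * L / 2 * √((n : ℝ) / K) * √(2 + C + (K : ℝ) / n) *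
            ((2 + Real.log t) / (√t - 1)))) := by
  refine ⟨⟨_, isDifferenceConstant_pi⟩, ?_⟩
  intro C hC n K hn hK L D hL0 hD X U F hX hXc hXD hconv hlip Ω _ P _ y hy x₁ hx₁ x
  have hC1 := one_le_of_isDifferenceConstant hC
  have hn' : (0 : ℝ) < n := by exact_mod_cast hn
  have hK' : (0 : ℝ) < K := by exact_mod_cast hK
  have hL : (0 : ℝ) < L := hL0
  have hM := batchScale_pos hn hK hL hC1
  have hA : 0 < C + (K : ℝ) / n := by positivity
  have hstep : ∀ t : ℕ, 1 ≤ t → 0 < stepSize n K L D C t := fun t ht => by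
    have : (0 : ℝ) < t := by exact_mod_cast ht
    unfold stepSize
    positivity
  have hdist : ∀ z ∈ X, ‖x₁ - z‖ ^ 2 ≤ 4 * D ^ 2 := fun z hz => by
    have h1 : ‖x₁ - z‖ ≤ 2 * D := by linarith [norm_sub_le x₁ z, hXD x₁ hx₁, hXD z hz]
    calc _ ≤ (2 * D) ^ 2 := by gcongr
      _ = _ := by ring
  have hsq : ∀ t : ℕ, 1 ≤ t → stepSize n K L D C t ^ 2 * batchScale n K L C ^ 2 =
      D ^ 2 / 2 * (1 / t) := fun t ht => by
    have : (0 : ℝ) < t := by exact_mod_cast ht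
    rw [stepSize_eq hC1 _ this.le, div_pow, div_pow, mul_pow, Real.sq_sqrt (by norm_num),
      Real.sq_sqrt this.le]
    field_simp
  refine ⟨fun h hh hU T hT hx => ?_, fun h hh hU hx t ht => ?_, fun hU hx t ht => ?_⟩
  · obtain ⟨hQc, hQl⟩ := convexOn_lipschitzOn_ballSmoothing hX hconv hlip hh.le hU
    have hpos := hstep T hT
    have key : ∀ z ∈ X, IsMinOn (ballSmoothing F h) X z → ∀ c : ℝ,
        ‖x₁ - z‖ ^ 2 / 2 + D ^ 2 / 4 ≤ c * D ^ 2 →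
        ExpectedErrorLE P (ballSmoothing F h) X
          (fun ω => (1 / (T : ℝ)) • ∑ t ∈ Finset.Icc 1 T, x t ω)
          (c * (L * D / √T * √(2 * n / K) * √(C + (K : ℝ) / n))) := by
      intro z hz hmin c hc
      obtain ⟨h1, h2⟩ := expected_gap_trajectoryAverage_le hn hK hC hX hXc hconv hlip
        (fun _ _ => hpos) (fun _ _ => hh) (fun _ _ => hU) hy hx₁ hx hQc hQl hz (ε := fun _ => 0)
        (fun _ _ _ _ => by simp) hT
      simp_rw [trajectoryAverage_const hpos.ne'] at h1 h2
      exact expectedErrorLE_of_isMinOn hz hmin h1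
        (h2.trans (constant_step_bound_le hn hK hL hD hC1 hT hc))
    refine ⟨?_, ?_⟩
    · obtain ⟨z, hz, hmin⟩ := hXc.exists_isMinOn ⟨x₁, hx₁⟩ hQl.continuousOn
      -- With `‖x₁ - z‖ ≤ 2D` the factor would be `9/4`; the stated `5/2` is slightly larger.
      exact key z hz hmin _ (by linarith [hdist z hz, sq_nonneg D])
    · rintro ⟨z, hz, hmin, hzD⟩
      have h3 : ‖x₁ - z‖ ^ 2 ≤ D ^ 2 := by gcongr
      have := key z hz hmin 1 (by linarith [sq_nonneg D])
      rwa [one_mul] at this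
  · obtain ⟨hQc, hQl⟩ := convexOn_lipschitzOn_ballSmoothing hX hconv hlip hh.le hU
    obtain ⟨z, hz, hmin⟩ := hXc.exists_isMinOn ⟨x₁, hx₁⟩ hQl.continuousOn
    obtain ⟨h1, h2⟩ := expected_gap_trajectoryAverage_le hn hK hC hX hXc hconv hlip
      hstep (fun _ _ => hh) (fun _ _ => hU) hy hx₁ hx hQc hQl hz (ε := fun _ => 0)
      (fun _ _ _ _ => by simp) (show 1 ≤ t by omega)
    have hlog := two_mul_sqrt_sub_one_le_log (T := t) (by omega)
    -- Here `t ≥ 2` matters: `log t ≥ 1/2` is needed below.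
    have hu : 1.4 ≤ √(t : ℝ) := by
      refine Real.le_sqrt_of_sq_le ?_
      have : (2 : ℝ) ≤ t := by exact_mod_cast ht
      norm_num
      linarith
    refine expectedErrorLE_of_isMinOn hz hmin h1 (h2.trans ?_)
    refine (decreasing_step_bound_le hn hK hL hD hC1 ht (κ := 1) (c := √2) (hdist z hz) zero_le_one
      (by positivity) ?_ fun t ht => ?_).trans_eq ?_
    · have hl : 1 / 2 ≤ Real.log t := by nlinarith
      rw [mul_assoc, mul_assoc]
      refine mul_le_mul_of_nonneg_left ?_ (by positivity)
      nlinarith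
    · rw [sq_batchScale hC1, hsq t ht]
      ring
    · rw [← bound_eq hn hK]
      have h2 : √2 / 2 = 1 / √2 := by
        rw [div_eq_div_iff (by norm_num) (by positivity), Real.mul_self_sqrt (by norm_num), one_mul]
      rw [h2]
      ring
  · have hht : ∀ t : ℕ, 1 ≤ t → 0 < L * stepSize n K L D C t / K := fun t ht => by
      have := hstep t ht
      positivity
    have hXU : X ⊆ U := (Metric.self_subset_cthickening X).trans (hU 1 le_rfl)
    have hFc := hconv.subset hXU hX
    have hFl := hlip.mono hXU
    obtain ⟨z, hz, hmin⟩ := hXc.exists_isMinOn ⟨x₁, hx₁⟩ hFl.continuousOn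
    obtain ⟨h1, h2⟩ := expected_gap_trajectoryAverage_le hn hK hC hX hXc hconv hlip
      hstep hht hU hy hx₁ hx hFc hFl hz
      (ε := fun t => L * (L * stepSize n K L D C t / K))
      (fun t ht u hu => sub_le_ballSmoothing_sub_add hconv hlip (hht t ht).le (hU t ht) hu hz)
      (show 1 ≤ t by omega)
    have hlog := two_mul_sqrt_sub_one_le_log (T := t) (by omega)
    have hu : 1 ≤ √(t : ℝ) := Real.one_le_sqrt.2 (by exact_mod_cast (by omega : 1 ≤ t))
    set κ : ℝ := (2 + C + K / n) / (C + K / n) with hκ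
    have hA1 : 1 ≤ C + (K : ℝ) / n := by
      have : 0 < (K : ℝ) / n := by positivity
      linarith
    have hκ1 : 1 ≤ κ := by
      rw [hκ, le_div_iff₀ hA]
      linarith
    have hκ3 : κ ≤ 3 := by
      rw [hκ, div_le_iff₀ hA]
      linarith
    refine expectedErrorLE_of_isMinOn hz hmin h1 (h2.trans ?_)
    refine (decreasing_step_bound_le hn hK hL hD hC1 ht (κ := κ) (c := √κ) (hdist z hz)
      (by linarith) (by positivity) ?_ fun t ht => ?_).trans_eq ?_
    · have hl0 : 0 ≤ Real.log t := Real.log_nonneg (by exact_mod_cast (by omega : 1 ≤ t))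
      have h3 := decreasing_smoothing_numeric (w := √(t : ℝ) - 1) (l := Real.log t) (r := √κ)
        (by linarith) hl0 (by linarith) (Real.one_le_sqrt.2 hκ1)
        (Real.sqrt_le_iff.2 ⟨by norm_num, hκ3.trans (by norm_num)⟩)
      rw [Real.sq_sqrt (by linarith)] at h3
      have h4 : √2 ≤ 1.4143 := Real.sqrt_le_iff.2 ⟨by norm_num, by norm_num⟩
      have h5 : 0 ≤ (4 + κ * (1 + Real.log t) / 2) * (√(t : ℝ) - 1) :=
        mul_nonneg (by positivity) (by linarith)
      have h6 := mul_le_mul_of_nonneg_right h4 h5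
      linarith
    · have h3 := hsq t ht
      have h4 : stepSize n K L D C t ^ 2 * (L ^ 2 / (n * K)) =
          D ^ 2 / 2 * (1 / t) / (C + K / n) := by
        rw [eq_div_iff hA.ne', ← h3, ← sq_batchScale hC1]
        ring
      calc _ = stepSize n K L D C t ^ 2 * (L ^ 2 / (n * K)) * (2 + C + K / n) := by
            field_simp
            ring
        _ = _ := by
            rw [h4, hκ]
            ring
    · have h3 : √(C + (K : ℝ) / n) * √κ = √(2 + C + K / n) := by
        rw [← Real.sqrt_mul hA.le, hκ, mul_div_cancel₀ _ hA.ne']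
      rw [← bound_eq hn hK, ← h3]
      ring
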